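/- **Proposition 2.1.** Let $N\ge 2$, $\mathbb R^N_+=\{x=(x',x_N)\in\mathbb R^{N-1}\times\mathbb R:\ x_N>0\}$, $\rho(x)=x_N$, $\mu_1=-\tfrac{N^2}{4}$ and $\mu\ge\mu_1$. Put $\alpha_\pm=\frac{2-N}{2}\pm\sqrt{\mu-\mu_1}$ and $\psi_1(x)=\frac{x_N}{|x|}$, and for $x\in\mathbb R^N_+$ with $r=|x|$ let $$\gamma_\mu(x)=r^{\alpha_+}\psi_1(x),\qquad \phi_\mu(x)=\begin{cases} r^{\alpha_-}\psi_1(x) & \text{if }\mu>\mu_1,\\ r^{-\frac{N-2}{2}}\ln(r^{-1})\,\psi_1(x)&\text{if }\mu=\mu_1.\end{cases}$$ Write $d\gamma_\mu(x)=\gamma_\mu(x)\,dx$ and $$\mathcal L^*_\mu\zeta=-\Delta\zeta-\frac{2}{\gamma_\mu}\langle\nabla\gamma_\mu,\nabla\zeta\rangle ,$$ understood in the sense of distributions in $\mathbb R^N_+$: a function $g\in L^1_{loc}(\mathbb R^N_+)$ equals $\mathcal L^*_\mu\zeta$ if $$\int_{\mathbb R^N_+}\zeta\Big(-\Delta\xi+2\,\mathrm{div}\big(\tfrac{\xi}{\gamma_\mu}\nabla\gamma_\mu\big)\Big)dx=\int_{\mathbb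 R^N_+} g\,\xi\,dx\qquad\text{for all }\xi\in C_c^\infty(\mathbb R^N_+).$$ Let $$\mathbb X_\mu(\mathbb R^N_+)=\big\{\zeta\in C_c(\overline{\mathbb R^N_+}):\ \mathcal L^*_\mu\zeta\in L^1_{loc}(\mathbb R^N_+)\ \text{and}\ \rho\,\mathcal L^*_\mu\zeta\in L^\infty(\mathbb R^N_+)\big\}.$$ Then $\phi_\mu$ belongs to $L^1_{loc}$ with respect to $\rho^{-1}d\gamma_\mu$, locally up to the boundary, i.e. $\int_{K\cap\mathbb R^N_+}|\phi_\mu|\,\rho^{-1}\,d\gamma_\mu<\infty$ for every compact $K\subset\overline{\mathbb R^N_+}$. Moreover, for every $\zeta\in\mathbb X_\mu(\mathbb R^N_+)$ the function $\phi_\mu\,\mathcal L^*_\mu\zeta$ is $d\gamma_\mu$-integrable on $\mathbb R^N_+$ and $$\int_{\mathbb R^N_+}\phi_\mu\,\mathcal L^*_\mu\zeta\,d\gamma_\mu=c_\mu\,\zeta(0),\qquad c_\mu=\begin{cases}2\sqrt{\mu-\mu_1}\displaystyle\int_{\mathbb S^{N-1}_+}\psi_1^2\,dS&\text{if }\mu>\mu_1,\\[2mm]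 \displaystyle\int_{\mathbb S^{N-1}_+}\psi_1^2\,dS&\text{if }\mu=\mu_1,\end{cases}$$ where $\mathbb S^{N-1}_+=\mathbb S^{N-1}\cap\mathbb R^N_+$ and $dS$ is the surface measure. -/

import Mathlib

open MeasureTheory Set
open scoped ContDiff InnerProductSpace

noncomputable section

/-!
The ambient space is `ℝ^N` with `N = n + 1`, so that the last coordinate `x_N` always exists.
-/

/-- Euclidean space `ℝ^N`, `N = n + 1`. -/
abbrev Space (n : ℕ) : Type := EuclideanSpace ℝ (Fin (n + 1))

/-- The open half-space `ℝ^N_+ = {x | x_N > 0}`. -/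
def halfSpace (n : ℕ) : Set (Space n) := {x | 0 < x (Fin.last n)}

/-- `ρ(x) = x_N`, for `x ∈ ℝ^N_+` the distance from `x` to the boundary of `ℝ^N_+`. -/
def rho (n : ℕ) (x : Space n) : ℝ := x (Fin.last n)

/-- The critical value `μ₁ = -N²/4`. -/
def muOne (n : ℕ) : ℝ := -((n : ℝ) + 1) ^ 2 / 4

/-- `α₊ = (2 - N)/2 + √(μ - μ₁)`. -/
def alphaPlus (n : ℕ) (μ : ℝ) : ℝ := (2 - ((n : ℝ) + 1)) / 2 + √(μ - muOne n)

/-- `α₋ = (2 - N)/2 - √(μ - μ₁)`. -/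
def alphaMinus (n : ℕ) (μ : ℝ) : ℝ := (2 - ((n : ℝ) + 1)) / 2 - √(μ - muOne n)

/-- `ψ₁ = x_N / |x|`. -/
def psiOne (n : ℕ) (x : Space n) : ℝ := x (Fin.last n) / ‖x‖

/-- The regular solution `γ_μ = r^{α₊} ψ₁`, `r = |x|`. -/
def gammaFun (n : ℕ) (μ : ℝ) (x : Space n) : ℝ := ‖x‖ ^ alphaPlus n μ * psiOne n x

open Classical in
/-- The singular solution `φ_μ`: `r^{α₋} ψ₁` if `μ ≠ μ₁` (the case `μ > μ₁`), and
`r^{-(N-2)/2} ln(r⁻¹) ψ₁` if `μ = μ₁`. -/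
def phiFun (n : ℕ) (μ : ℝ) (x : Space n) : ℝ :=
  if μ = muOne n then
    ‖x‖ ^ (-(((n : ℝ) + 1) - 2) / 2) * Real.log ‖x‖⁻¹ * psiOne n x
  else ‖x‖ ^ alphaMinus n μ * psiOne n x

/-- The measure `dγ_μ = γ_μ dx` on `ℝ^N_+`. -/
def gammaMeasure (n : ℕ) (μ : ℝ) : Measure (Space n) :=
  (volume.restrict (halfSpace n)).withDensity fun x => ENNReal.ofReal (gammaFun n μ x)

/-- The measure `ρ⁻¹ dγ_μ` on `ℝ^N_+`. -/
def rhoInvGammaMeasure (n : ℕ) (μ : ℝ) : Measure (Space n) :=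
  (gammaMeasure n μ).withDensity fun x => ENNReal.ofReal (rho n x)⁻¹

/-- The divergence of a vector field on `ℝ^N`. -/
def divergence (n : ℕ) (F : Space n → Space n) (x : Space n) : ℝ :=
  ∑ i, fderiv ℝ (fun y => F y i) x (EuclideanSpace.single i 1)

/-- The `dx`-transpose `ξ ↦ -Δξ + 2 div((ξ / γ_μ) ∇γ_μ)` of the dual operator
`L*_μ ζ = -Δζ - (2 / γ_μ) ⟨∇γ_μ, ∇ζ⟩`. -/
def dualTranspose (n : ℕ) (μ : ℝ) (ξ : Space n → ℝ) (x : Space n) : ℝ :=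
  -Laplacian.laplacian ξ x
    + 2 * divergence n (fun y => (ξ y / gammaFun n μ y) • gradient (gammaFun n μ) y) x

/-- `g = L*_μ ζ` in the sense of distributions in the open half-space, where
`L*_μ ζ = -Δζ - (2 / γ_μ) ⟨∇γ_μ, ∇ζ⟩`. -/
def IsDualOf (n : ℕ) (μ : ℝ) (ζ g : Space n → ℝ) : Prop :=
  LocallyIntegrableOn g (halfSpace n) ∧
  ∀ ξ : Space n → ℝ, ContDiff ℝ ∞ ξ → HasCompactSupport ξ → tsupport ξ ⊆ halfSpace n →
    ∫ x in halfSpace n, ζ x * dualTranspose n μ ξ x = ∫ x in halfSpace n, g x * ξ x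

/-- The test function space `X_μ(ℝ^N_+)`: the continuous functions with compact support on the
closed half-space such that `ρ L*_μ ζ ∈ L^∞(ℝ^N_+)`. The values of `ζ` outside the closed
half-space play no role. -/
def testSpace (n : ℕ) (μ : ℝ) : Set (Space n → ℝ) :=
  {ζ | ContinuousOn ζ (closure (halfSpace n)) ∧
    (∃ K : Set (Space n), IsCompact K ∧ ∀ x ∈ closure (halfSpace n) \ K, ζ x = 0) ∧
    ∃ g : Space n → ℝ, IsDualOf n μ ζ g ∧
      MemLp (fun x => rho n x * g x) ⊤ (volume.restrict (halfSpace n))}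

/-- `∫_{S^{N-1}_+} ψ₁² dS`, with the surface measure on the unit sphere. -/
def psiOneSqIntegral (n : ℕ) : ℝ :=
  ∫ σ in {σ : Metric.sphere (0 : Space n) 1 | (σ : Space n) ∈ halfSpace n},
    psiOne n (σ : Space n) ^ 2 ∂(volume : Measure (Space n)).toSphere

open Classical in
/-- `c_μ = 2 √(μ - μ₁) ∫ ψ₁² dS` if `μ ≠ μ₁` (the case `μ > μ₁`), and `∫ ψ₁² dS` if `μ = μ₁`. -/
def cConst (n : ℕ) (μ : ℝ) : ℝ :=
  if μ = muOne n then psiOneSqIntegral n else 2 * √(μ - muOne n) * psiOneSqIntegral n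

end

/-!
With `t = -log |x|`, the product `φ_μ γ_μ` is `x_N² |x|^{-N} y(t)` for an affine `y`, and the
ground-state substitution by `γ_μ` shows that the transpose of `L*_μ` maps `x_N² |x|^{-N} y(t)` to
`x_N² |x|^{-N-2} (-y'' - 2 s y')(t)`, where `s = √(μ - μ₁)`. The affine `y` in question is
annihilated by `-y'' - 2 s y'`. Two truncations make such functions admissible. A cutoff in
`x_N / ε` removes the boundary: its commutator is bounded uniformly in `ε` away from the origin and
tends to `0` pointwise, so it disappears as `ε → 0`. Cutting off the affine `y` between `t = T` and
`t = 2T` removes the origin: this creates a source of total mass `c_μ` on the half-annulus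
`e^{-2T} ≤ |x| ≤ e^{-T}`, which concentrates at `0` as `T → ∞`.
-/

noncomputable section

open Filter Topology

theorem neg_log_norm_eq_comp_norm_sq {E : Type*} [NormedAddCommGroup E] :
    (fun y : E => -Real.log ‖y‖) = fun y => -(1 / 2) * Real.log (‖y‖ ^ 2) := by
  ext y
  rw [Real.log_pow]
  ring

section LaplacianCalculus

variable {E : Type*} [NormedAddCommGroup E] [InnerProductSpace ℝ E]

theorem differentiableAt_fderiv_of_contDiffAt_two {f : E → ℝ} {x : E} (hf : ContDiffAt ℝ 2 f x) :
    DifferentiableAt ℝ (fderiv ℝ f) x :=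
  (hf.fderiv_right (m := 1) (by norm_num)).differentiableAt (by simp)

theorem eventually_differentiableAt_of_contDiffAt_two {f : E → ℝ} {x : E}
    (hf : ContDiffAt ℝ 2 f x) : ∀ᶠ y in 𝓝 x, DifferentiableAt ℝ f y :=
  (hf.eventually (by simp)).mono fun _ h => h.differentiableAt (by simp)

theorem fderiv_fderiv_mul_apply_self {f g : E → ℝ} {x : E} (hf : ContDiffAt ℝ 2 f x)
    (hg : ContDiffAt ℝ 2 g x) (v : E) :
    fderiv ℝ (fderiv ℝ fun y => f y * g y) x v v =
      f x * fderiv ℝ (fderiv ℝ g) x v v + 2 * (fderiv ℝ f x v * fderiv ℝ g x v) +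
        g x * fderiv ℝ (fderiv ℝ f) x v v := by
  have hfd := eventually_differentiableAt_of_contDiffAt_two hf
  have hgd := eventually_differentiableAt_of_contDiffAt_two hg
  have hfirst : (fderiv ℝ fun y => f y * g y) =ᶠ[𝓝 x]
      fun y => f y • fderiv ℝ g y + g y • fderiv ℝ f y := by
    filter_upwards [hfd, hgd] with y hfy hgy using fderiv_fun_mul hfy hgy
  have hsecond := (hfd.self_of_nhds.hasFDerivAt.smul
    (differentiableAt_fderiv_of_contDiffAt_two hg).hasFDerivAt).fun_add
    (hgd.self_of_nhds.hasFDerivAt.smul (differentiableAt_fderiv_of_contDiffAt_two hf).hasFDerivAt)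
  rw [(hsecond.congr_of_eventuallyEq hfirst).fderiv]
  simp only [add_apply, smul_apply, ContinuousLinearMap.smulRight_apply, smul_eq_mul]
  ring

theorem fderiv_fderiv_comp_apply_self {F : ℝ → ℝ} {u : E → ℝ} {x : E}
    (hF : ContDiffAt ℝ 2 F (u x)) (hu : ContDiffAt ℝ 2 u x) (v : E) :
    fderiv ℝ (fderiv ℝ fun y => F (u y)) x v v =
      deriv (deriv F) (u x) * (fderiv ℝ u x v * fderiv ℝ u x v) +
        deriv F (u x) * fderiv ℝ (fderiv ℝ u) x v v := by
  have hud := eventually_differentiableAt_of_contDiffAt_two hu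
  have hFd := hu.continuousAt.eventually (eventually_differentiableAt_of_contDiffAt_two hF)
  have hfirst : (fderiv ℝ fun y => F (u y)) =ᶠ[𝓝 x] fun y => deriv F (u y) • fderiv ℝ u y := by
    filter_upwards [hud, hFd] with y huy hFy
      using (hFy.hasDerivAt.comp_hasFDerivAt y huy.hasFDerivAt).fderiv
  have hDF : DifferentiableAt ℝ (deriv F) (u x) :=
    (hF.derivWithin (m := 1) (by norm_num)).differentiableAt (by simp)
  have hsecond := (hDF.hasDerivAt.comp_hasFDerivAt x hud.self_of_nhds.hasFDerivAt).smul
    (differentiableAt_fderiv_of_contDiffAt_two hu).hasFDerivAt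
  rw [(hsecond.congr_of_eventuallyEq hfirst).fderiv]
  simp only [add_apply, smul_apply, ContinuousLinearMap.smulRight_apply, smul_eq_mul,
    Function.comp_apply]
  ring

theorem contDiffAt_neg_log_norm {m : WithTop ℕ∞} {x : E} (hx : x ≠ 0) :
    ContDiffAt ℝ m (fun y : E => -Real.log ‖y‖) x :=
  ((contDiffAt_norm ℝ hx).log (norm_ne_zero_iff.2 hx)).neg

section Gradient

variable [CompleteSpace E]

theorem sum_fderiv_mul_fderiv {ι : Type*} [Fintype ι] (b : OrthonormalBasis ι ℝ E)
    (f g : E → ℝ) (x : E) :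
    ∑ i, fderiv ℝ f x (b i) * fderiv ℝ g x (b i) = ⟪gradient f x, gradient g x⟫_ℝ := by
  rw [← b.sum_inner_mul_inner]
  simp [inner_gradient_left, inner_gradient_right]

theorem gradient_comp {F : ℝ → ℝ} {u : E → ℝ} {x : E} (hF : DifferentiableAt ℝ F (u x))
    (hu : DifferentiableAt ℝ u x) :
    gradient (fun y => F (u y)) x = deriv F (u x) • gradient u x := by
  have hcomp : fderiv ℝ (fun y => F (u y)) x = deriv F (u x) • fderiv ℝ u x :=
    (hF.hasDerivAt.comp_hasFDerivAt x hu.hasFDerivAt).fderiv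
  simp [gradient, hcomp]

theorem gradient_norm_sq (x : E) : gradient (fun y : E => ‖y‖ ^ 2) x = (2 : ℝ) • x := by
  refine ext_inner_right ℝ fun v => ?_
  simp [inner_gradient_left, inner_smul_left]

theorem gradient_neg_log_norm {x : E} (hx : x ≠ 0) :
    gradient (fun y : E => -Real.log ‖y‖) x = -(‖x‖ ^ 2)⁻¹ • x := by
  have hp : ‖x‖ ^ 2 ≠ 0 := by simpa using hx
  have hlog := (Real.hasDerivAt_log hp).const_mul (-(1 / 2))
  have hsq : DifferentiableAt ℝ (fun y : E => ‖y‖ ^ 2) x := differentiableAt_id.norm_sq ℝ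
  rw [neg_log_norm_eq_comp_norm_sq,
    gradient_comp (F := fun u => -(1 / 2) * Real.log u) (u := fun y => ‖y‖ ^ 2)
      hlog.differentiableAt hsq,
    hlog.deriv, gradient_norm_sq, smul_smul]
  ring_nf

end Gradient

variable [FiniteDimensional ℝ E]

theorem laplacian_eq_sum_fderiv_fderiv {ι : Type*} [Fintype ι] (b : OrthonormalBasis ι ℝ E)
    (f : E → ℝ) (x : E) : Laplacian.laplacian f x = ∑ i, fderiv ℝ (fderiv ℝ f) x (b i) (b i) := by
  simp [InnerProductSpace.laplacian_eq_iteratedFDeriv_orthonormalBasis f b,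
    iteratedFDeriv_two_apply]

theorem laplacian_continuousLinearMap (L : E →L[ℝ] ℝ) (x : E) :
    Laplacian.laplacian (fun y => L y) x = 0 := by
  have hconst : fderiv ℝ (fun y => L y) = fun _ => L := funext fun _ => L.fderiv
  simp [laplacian_eq_sum_fderiv_fderiv (stdOrthonormalBasis ℝ E), hconst]

theorem laplacian_norm_sq (x : E) :
    Laplacian.laplacian (fun y : E => ‖y‖ ^ 2) x = 2 * Module.finrank ℝ E := by
  have hfirst : fderiv ℝ (fun y : E => ‖y‖ ^ 2) = (2 • innerSL ℝ : E →L[ℝ] E →L[ℝ] ℝ) :=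
    fderiv_norm_sq
  have hsecond (v : E) : fderiv ℝ (fderiv ℝ fun y : E => ‖y‖ ^ 2) x v v = 2 * ⟪v, v⟫_ℝ := by
    rw [hfirst, ContinuousLinearMap.fderiv, two_smul, two_mul]
    rfl
  simp [laplacian_eq_sum_fderiv_fderiv (stdOrthonormalBasis ℝ E), hsecond, mul_comm]

variable [CompleteSpace E]

theorem laplacian_mul {f g : E → ℝ} {x : E} (hf : ContDiffAt ℝ 2 f x)
    (hg : ContDiffAt ℝ 2 g x) :
    Laplacian.laplacian (fun y => f y * g y) x =
      f x * Laplacian.laplacian g x + 2 * ⟪gradient f x, gradient g x⟫_ℝ +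
        g x * Laplacian.laplacian f x := by
  let b := stdOrthonormalBasis ℝ E
  simp only [laplacian_eq_sum_fderiv_fderiv b, fderiv_fderiv_mul_apply_self hf hg,
    ← sum_fderiv_mul_fderiv b, Finset.mul_sum, Finset.sum_add_distrib]

theorem laplacian_comp {F : ℝ → ℝ} {u : E → ℝ} {x : E} (hF : ContDiffAt ℝ 2 F (u x))
    (hu : ContDiffAt ℝ 2 u x) :
    Laplacian.laplacian (fun y => F (u y)) x =
      deriv (deriv F) (u x) * ‖gradient u x‖ ^ 2 + deriv F (u x) * Laplacian.laplacian u x := by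
  let b := stdOrthonormalBasis ℝ E
  rw [← real_inner_self_eq_norm_sq]
  simp only [laplacian_eq_sum_fderiv_fderiv b, fderiv_fderiv_comp_apply_self hF hu,
    ← sum_fderiv_mul_fderiv b, Finset.mul_sum, Finset.sum_add_distrib]

theorem laplacian_neg_log_norm {x : E} (hx : x ≠ 0) :
    Laplacian.laplacian (fun y : E => -Real.log ‖y‖) x =
      -(Module.finrank ℝ E - 2) / ‖x‖ ^ 2 := by
  have hp : ‖x‖ ^ 2 ≠ 0 := by simpa using hx
  have hfirst : (deriv fun u => -(1 / 2) * Real.log u) = fun u => -(1 / 2) * u⁻¹ := by simp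
  rw [neg_log_norm_eq_comp_norm_sq,
    laplacian_comp (F := fun u => -(1 / 2) * Real.log u) (u := fun y => ‖y‖ ^ 2)
    (contDiffAt_const.mul (Real.contDiffAt_log.2 hp)) (contDiff_norm_sq ℝ).contDiffAt,
    hfirst, gradient_norm_sq, laplacian_norm_sq, norm_smul]
  simp only [deriv_const_mul_field, deriv_inv', Real.norm_ofNat]
  field_simp
  ring

theorem laplacian_comp_neg_log_norm {F : ℝ → ℝ} (hF : ContDiff ℝ 2 F) {x : E} (hx : x ≠ 0) :
    Laplacian.laplacian (fun y : E => F (-Real.log ‖y‖)) x =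
      (deriv (deriv F) (-Real.log ‖x‖) -
        (Module.finrank ℝ E - 2) * deriv F (-Real.log ‖x‖)) / ‖x‖ ^ 2 := by
  have hnorm : ‖x‖ ≠ 0 := norm_ne_zero_iff.2 hx
  rw [laplacian_comp hF.contDiffAt (contDiffAt_neg_log_norm hx), gradient_neg_log_norm hx,
    laplacian_neg_log_norm hx, norm_smul]
  simp only [norm_neg, norm_inv, norm_pow, norm_norm]
  field_simp
  ring

end LaplacianCalculus

theorem contDiffAt_lastCoord {n : ℕ} {m : WithTop ℕ∞} (x : Space n) :
    ContDiffAt ℝ m (fun y : Space n => y (Fin.last n)) x :=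
  (EuclideanSpace.proj (𝕜 := ℝ) (Fin.last n)).contDiff.contDiffAt

theorem gradient_lastCoord {n : ℕ} (x : Space n) :
    gradient (fun y : Space n => y (Fin.last n)) x = EuclideanSpace.single (Fin.last n) 1 := by
  refine ext_inner_right ℝ fun v => ?_
  have hfderiv :
      fderiv ℝ (fun y : Space n => y (Fin.last n)) x = EuclideanSpace.proj (Fin.last n) :=
    (EuclideanSpace.proj (𝕜 := ℝ) (Fin.last n)).fderiv
  simp [inner_gradient_left, hfderiv, EuclideanSpace.inner_single_left]

theorem laplacian_lastCoord {n : ℕ} (x : Space n) :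
    Laplacian.laplacian (fun y : Space n => y (Fin.last n)) x = 0 :=
  laplacian_continuousLinearMap (EuclideanSpace.proj (𝕜 := ℝ) (Fin.last n)) x

theorem laplacian_comp_lastCoord {n : ℕ} {b : ℝ → ℝ} (hb : ContDiff ℝ 2 b) (x : Space n) :
    Laplacian.laplacian (fun y : Space n => b (y (Fin.last n))) x =
      deriv (deriv b) (x (Fin.last n)) := by
  rw [laplacian_comp hb.contDiffAt (contDiffAt_lastCoord x), gradient_lastCoord,
    laplacian_lastCoord]
  simp

theorem laplacian_lastCoord_mul_neg_log_norm {n : ℕ} {b F : ℝ → ℝ} (hb : ContDiff ℝ 2 b)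
    (hF : ContDiff ℝ 2 F) {x : Space n} (hx : x ≠ 0) :
    Laplacian.laplacian (fun y : Space n => b (y (Fin.last n)) * F (-Real.log ‖y‖)) x =
      deriv (deriv b) (x (Fin.last n)) * F (-Real.log ‖x‖) +
        (b (x (Fin.last n)) *
            (deriv (deriv F) (-Real.log ‖x‖) - ((n : ℝ) - 1) * deriv F (-Real.log ‖x‖)) -
          2 * x (Fin.last n) * deriv b (x (Fin.last n)) * deriv F (-Real.log ‖x‖)) / ‖x‖ ^ 2 := by
  have hz := contDiffAt_lastCoord (m := 2) x
  have ht := contDiffAt_neg_log_norm (m := 2) hx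
  rw [laplacian_mul (f := fun y : Space n => b (y (Fin.last n)))
      (g := fun y => F (-Real.log ‖y‖)) (hb.contDiffAt.comp x hz) (hF.contDiffAt.comp x ht),
    laplacian_comp_lastCoord hb, laplacian_comp_neg_log_norm hF hx,
    gradient_comp (hb.differentiable (by simp) _) (hz.differentiableAt (by simp)),
    gradient_comp (hF.differentiable (by simp) _) (ht.differentiableAt (by simp)),
    gradient_lastCoord, gradient_neg_log_norm hx, finrank_euclideanSpace_fin]
  push_cast
  simp only [inner_smul_left, inner_smul_right, EuclideanSpace.inner_single_left, map_one, one_mul,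
    conj_trivial]
  ring

theorem gradient_apply_eq_fderiv_single {ι : Type*} [Fintype ι] [DecidableEq ι]
    (f : EuclideanSpace ℝ ι → ℝ) (x : EuclideanSpace ℝ ι) (i : ι) :
    gradient f x i = fderiv ℝ f x (EuclideanSpace.single i 1) := by
  rw [← inner_gradient_left, EuclideanSpace.inner_single_right]
  simp

theorem divergence_smul_gradient {n : ℕ} {f g : Space n → ℝ} {x : Space n}
    (hf : DifferentiableAt ℝ f x) (hg : ContDiffAt ℝ 2 g x) :
    divergence n (fun y => f y • gradient g y) x =
      ⟪gradient f x, gradient g x⟫_ℝ + f x * Laplacian.laplacian g x := by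
  let b := EuclideanSpace.basisFun (Fin (n + 1)) ℝ
  have hDg := differentiableAt_fderiv_of_contDiffAt_two hg
  have hcomponent (i : Fin (n + 1)) :
      fderiv ℝ (fun y => (f y • gradient g y) i) x (EuclideanSpace.single i 1) =
        fderiv ℝ f x (b i) * fderiv ℝ g x (b i) +
          f x * fderiv ℝ (fderiv ℝ g) x (b i) (b i) := by
    simp only [PiLp.smul_apply, smul_eq_mul, gradient_apply_eq_fderiv_single]
    rw [(hf.hasFDerivAt.fun_mul (hDg.hasFDerivAt.clm_apply (hasFDerivAt_const _ x))).fderiv]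
    simp [b]
    ring
  simp only [divergence, hcomponent, Finset.sum_add_distrib, sum_fderiv_mul_fderiv b,
    laplacian_eq_sum_fderiv_fderiv b, Finset.mul_sum]

theorem isOpen_halfSpace (n : ℕ) : IsOpen (halfSpace n) :=
  isOpen_lt continuous_const (by fun_prop)

theorem ne_zero_of_mem_halfSpace {n : ℕ} {x : Space n} (hx : x ∈ halfSpace n) : x ≠ 0 := by
  rintro rfl
  simp [halfSpace] at hx

theorem norm_pos_of_mem_halfSpace {n : ℕ} {x : Space n} (hx : x ∈ halfSpace n) : 0 < ‖x‖ :=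
  norm_pos_iff.2 (ne_zero_of_mem_halfSpace hx)

theorem gammaFun_eq_lastCoord_mul_exp {n : ℕ} (μ : ℝ) {x : Space n} (hx : x ≠ 0) :
    gammaFun n μ x =
      x (Fin.last n) * Real.exp ((((n : ℝ) + 1) / 2 - √(μ - muOne n)) * -Real.log ‖x‖) := by
  have hnorm : 0 < ‖x‖ := norm_pos_iff.2 hx
  have hexponent : alphaPlus n μ - 1 = -(((n : ℝ) + 1) / 2 - √(μ - muOne n)) := by
    rw [alphaPlus]
    ring
  rw [gammaFun, psiOne, mul_div_left_comm, ← Real.rpow_sub_one hnorm.ne', hexponent,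
    Real.rpow_def_of_pos hnorm]
  ring_nf

theorem gammaFun_pos {n : ℕ} (μ : ℝ) {x : Space n} (hx : x ∈ halfSpace n) :
    0 < gammaFun n μ x := by
  rw [gammaFun_eq_lastCoord_mul_exp μ (ne_zero_of_mem_halfSpace hx)]
  exact mul_pos hx (Real.exp_pos _)

theorem gammaFun_eventuallyEq {n : ℕ} (μ : ℝ) {x : Space n} (hx : x ≠ 0) :
    gammaFun n μ =ᶠ[𝓝 x] fun y => y (Fin.last n) *
      Real.exp ((((n : ℝ) + 1) / 2 - √(μ - muOne n)) * -Real.log ‖y‖) :=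
  (eventually_ne_nhds hx).mono fun _ hy => gammaFun_eq_lastCoord_mul_exp μ hy

theorem contDiffAt_gammaFun {n : ℕ} (μ : ℝ) {m : WithTop ℕ∞} {x : Space n} (hx : x ≠ 0) :
    ContDiffAt ℝ m (gammaFun n μ) x :=
  ((contDiffAt_lastCoord x).mul
    (contDiffAt_const.mul (contDiffAt_neg_log_norm hx)).exp).congr_of_eventuallyEq
    (gammaFun_eventuallyEq μ hx)

theorem deriv_exp_mul_mul {y : ℝ → ℝ} (hy : Differentiable ℝ y) (k : ℝ) :
    (deriv fun t => Real.exp (k * t) * y t) =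
      fun t => Real.exp (k * t) * (deriv y t + k * y t) := by
  ext t
  have hexp : HasDerivAt (fun t => Real.exp (k * t)) (Real.exp (k * t) * k) t := by
    simpa using ((hasDerivAt_id t).const_mul k).exp
  rw [(hexp.fun_mul (hy t).hasDerivAt).deriv]
  ring

theorem deriv_deriv_exp_mul_mul {y : ℝ → ℝ} (hy : ContDiff ℝ 2 y) (k t : ℝ) :
    deriv (deriv fun t => Real.exp (k * t) * y t) t =
      Real.exp (k * t) * (deriv (deriv y) t + 2 * k * deriv y t + k ^ 2 * y t) := by
  have hyd := hy.differentiable (by simp)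
  have hdy : Differentiable ℝ (deriv y) := hy.differentiable_deriv_two
  rw [deriv_exp_mul_mul hyd, deriv_exp_mul_mul (y := fun t => deriv y t + k * y t)
    (hdy.add (hyd.const_mul k))]
  simp only [deriv_fun_add (hdy t) ((hyd t).const_mul k), deriv_const_mul_field]
  ring

theorem deriv_id_mul {c : ℝ → ℝ} (hc : Differentiable ℝ c) :
    (deriv fun z => z * c z) = fun z => c z + z * deriv c z := by
  ext z
  rw [((hasDerivAt_id' z).fun_mul (hc z).hasDerivAt).deriv, one_mul]

theorem deriv_deriv_id_mul {c : ℝ → ℝ} (hc : ContDiff ℝ 2 c) (z : ℝ) :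
    deriv (deriv fun z => z * c z) z = 2 * deriv c z + z * deriv (deriv c) z := by
  have hcd := hc.differentiable (by simp)
  have hdc : Differentiable ℝ (deriv c) := hc.differentiable_deriv_two
  rw [deriv_id_mul hcd, deriv_fun_add (hcd z) (differentiableAt_fun_id.fun_mul (hdc z)),
    deriv_id_mul hdc]
  ring

theorem laplacian_gammaFun {n : ℕ} (μ : ℝ) {x : Space n} (hx : x ≠ 0) :
    Laplacian.laplacian (gammaFun n μ) x =
      (√(μ - muOne n) ^ 2 - ((n : ℝ) + 1) ^ 2 / 4) / ‖x‖ ^ 2 * gammaFun n μ x := by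
  have hF : ContDiff ℝ 2 fun t => Real.exp ((((n : ℝ) + 1) / 2 - √(μ - muOne n)) * t) * 1 := by
    fun_prop
  have hγ := gammaFun_eventuallyEq μ hx
  have hform := laplacian_lastCoord_mul_neg_log_norm contDiff_id hF hx
  rw [deriv_deriv_exp_mul_mul contDiff_const, deriv_exp_mul_mul (differentiable_const _)] at hform
  simp only [deriv_const', deriv_id', id, mul_one] at hform
  rw [(InnerProductSpace.laplacian_congr_nhds hγ).self_of_nhds, hform,
    gammaFun_eq_lastCoord_mul_exp μ hx]
  ring

theorem dualTranspose_congr_nhds {n : ℕ} {μ : ℝ} {ξ ξ' : Space n → ℝ} {x : Space n}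
    (h : ξ =ᶠ[𝓝 x] ξ') : dualTranspose n μ ξ x = dualTranspose n μ ξ' x := by
  have hcomponent (i : Fin (n + 1)) :
      (fun y => ((ξ y / gammaFun n μ y) • gradient (gammaFun n μ) y) i) =ᶠ[𝓝 x]
        fun y => ((ξ' y / gammaFun n μ y) • gradient (gammaFun n μ) y) i := by
    filter_upwards [h] with y hy
    rw [hy]
  rw [dualTranspose, dualTranspose, (InnerProductSpace.laplacian_congr_nhds h).self_of_nhds]
  simp only [divergence, (hcomponent _).fderiv_eq]

theorem dualTranspose_eq_zero_of_notMem_tsupport {n : ℕ} {μ : ℝ} {ξ : Space n → ℝ} {x : Space n}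
    (hx : x ∉ tsupport ξ) : dualTranspose n μ ξ x = 0 := by
  rw [dualTranspose_congr_nhds (notMem_tsupport_iff_eventuallyEq.1 hx)]
  simp [dualTranspose, divergence, Pi.zero_def]

theorem dualTranspose_gammaFun_mul {n : ℕ} {μ : ℝ} {η : Space n → ℝ} {x : Space n}
    (hη : ContDiffAt ℝ 2 η x) (hx : x ∈ halfSpace n) :
    dualTranspose n μ (fun y => gammaFun n μ y * η y) x =
      η x * Laplacian.laplacian (gammaFun n μ) x - gammaFun n μ x * Laplacian.laplacian η x := by
  have hγ : ContDiffAt ℝ 2 (gammaFun n μ) x := contDiffAt_gammaFun μ (ne_zero_of_mem_halfSpace hx)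
  have hquotient (i : Fin (n + 1)) :
      (fun y => ((gammaFun n μ y * η y / gammaFun n μ y) • gradient (gammaFun n μ) y) i) =ᶠ[𝓝 x]
        fun y => (η y • gradient (gammaFun n μ) y) i := by
    filter_upwards [(isOpen_halfSpace n).mem_nhds hx] with y hy
    rw [mul_div_cancel_left₀ _ (gammaFun_pos μ hy).ne']
  have hdiv : divergence n
      (fun y => (gammaFun n μ y * η y / gammaFun n μ y) • gradient (gammaFun n μ) y) x =
        ⟪gradient η x, gradient (gammaFun n μ) x⟫_ℝ +
          η x * Laplacian.laplacian (gammaFun n μ) x := by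
    rw [← divergence_smul_gradient (hη.differentiableAt (by simp)) hγ]
    simp only [divergence, (hquotient _).fderiv_eq]
  rw [dualTranspose, hdiv, laplacian_mul hγ hη, real_inner_comm]
  ring

/-- The function `x_N² |x|^{-k} y(t)` with `t = -log |x|`. For `k = N` and `y` affine it is
`φ_μ γ_μ`; for `k = N + 2` its integral over the half-space factors through `∫ y dt`. -/
def logProfile (n k : ℕ) (y : ℝ → ℝ) (x : Space n) : ℝ :=
  x (Fin.last n) ^ 2 * ((‖x‖ ^ k)⁻¹ * y (-Real.log ‖x‖))

/-- The operator `y ↦ -y'' - 2 s y'` in the variable `t = -log |x|`: with `s = √(μ - μ₁)`, the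
transpose of `L*_μ` maps `x_N² |x|^{-N} y(t)` to `x_N² |x|^{-N-2} (-y'' - 2 s y')(t)`. -/
def radialOp (s : ℝ) (y : ℝ → ℝ) (t : ℝ) : ℝ :=
  -deriv (deriv y) t - 2 * s * deriv y t

/-- The terms containing a derivative of `c` in the transpose of `L*_μ` applied to
`c(x_N) x_N² |x|^{-N} y(-log |x|)`, where `s = √(μ - μ₁)`. -/
def cutoffCommutator (n : ℕ) (s : ℝ) (c y : ℝ → ℝ) (x : Space n) : ℝ :=
  (‖x‖ ^ (n + 1))⁻¹ *
    (2 * (x (Fin.last n) ^ 2 / ‖x‖ ^ 2) * (x (Fin.last n) * deriv c (x (Fin.last n))) *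
        (deriv y (-Real.log ‖x‖) + (((n : ℝ) + 1) / 2 + s) * y (-Real.log ‖x‖)) -
      (2 * (x (Fin.last n) * deriv c (x (Fin.last n))) +
        x (Fin.last n) ^ 2 * deriv (deriv c) (x (Fin.last n))) * y (-Real.log ‖x‖))

theorem inv_norm_pow_eq_exp {E : Type*} [NormedAddCommGroup E] {x : E} (hx : x ≠ 0) (k : ℕ) :
    (‖x‖ ^ k)⁻¹ = Real.exp (k * -Real.log ‖x‖) := by
  rw [mul_neg, Real.exp_neg, Real.exp_nat_mul, Real.exp_log (norm_pos_iff.2 hx)]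

theorem mul_logProfile_eq_gammaFun_mul {n : ℕ} (μ : ℝ) (c y : ℝ → ℝ) {x : Space n} (hx : x ≠ 0) :
    c (x (Fin.last n)) * logProfile n (n + 1) y x =
      gammaFun n μ x * (x (Fin.last n) * c (x (Fin.last n)) *
        (Real.exp ((((n : ℝ) + 1) / 2 + √(μ - muOne n)) * -Real.log ‖x‖) * y (-Real.log ‖x‖))) := by
  have hexp : (‖x‖ ^ (n + 1))⁻¹ =
      Real.exp ((((n : ℝ) + 1) / 2 - √(μ - muOne n)) * -Real.log ‖x‖) *
        Real.exp ((((n : ℝ) + 1) / 2 + √(μ - muOne n)) * -Real.log ‖x‖) := by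
    rw [inv_norm_pow_eq_exp hx, ← Real.exp_add]
    push_cast
    ring_nf
  rw [logProfile, hexp, gammaFun_eq_lastCoord_mul_exp μ hx]
  ring

theorem dualTranspose_mul_logProfile {n : ℕ} (μ : ℝ) {c y : ℝ → ℝ} (hc : ContDiff ℝ 2 c)
    (hy : ContDiff ℝ 2 y) {x : Space n} (hx : x ∈ halfSpace n) :
    dualTranspose n μ (fun x => c (x (Fin.last n)) * logProfile n (n + 1) y x) x =
      c (x (Fin.last n)) * logProfile n (n + 3) (radialOp √(μ - muOne n) y) x +
        cutoffCommutator n √(μ - muOne n) c y x := by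
  set s := √(μ - muOne n) with hs
  have hx0 := ne_zero_of_mem_halfSpace hx
  have hb : ContDiff ℝ 2 fun z => z * c z := contDiff_id.mul hc
  have hF : ContDiff ℝ 2 fun t => Real.exp ((((n : ℝ) + 1) / 2 + s) * t) * y t := by fun_prop
  have hsubst : (fun x => c (x (Fin.last n)) * logProfile n (n + 1) y x) =ᶠ[𝓝 x]
      fun x => gammaFun n μ x * (x (Fin.last n) * c (x (Fin.last n)) *
        (Real.exp ((((n : ℝ) + 1) / 2 + s) * -Real.log ‖x‖) * y (-Real.log ‖x‖))) :=
    (eventually_ne_nhds hx0).mono fun x hx => mul_logProfile_eq_gammaFun_mul μ c y hx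
  have hη : ContDiffAt ℝ 2 (fun x : Space n => x (Fin.last n) * c (x (Fin.last n)) *
      (Real.exp ((((n : ℝ) + 1) / 2 + s) * -Real.log ‖x‖) * y (-Real.log ‖x‖))) x :=
    (hb.contDiffAt.comp x (contDiffAt_lastCoord x)).mul
      (hF.contDiffAt.comp x (contDiffAt_neg_log_norm hx0))
  have hγ : gammaFun n μ x = x (Fin.last n) * (‖x‖ ^ (n + 1))⁻¹ /
      Real.exp ((((n : ℝ) + 1) / 2 + s) * -Real.log ‖x‖) := by
    rw [gammaFun_eq_lastCoord_mul_exp μ hx0, inv_norm_pow_eq_exp hx0, mul_div_assoc,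
      ← Real.exp_sub]
    push_cast
    congr 2
    ring
  rw [dualTranspose_congr_nhds hsubst, dualTranspose_gammaFun_mul hη hx, laplacian_gammaFun μ hx0,
    laplacian_lastCoord_mul_neg_log_norm hb hF hx0, hγ, logProfile, cutoffCommutator, pow_add _ n 3,
    pow_add _ n 1, deriv_deriv_id_mul hc, deriv_id_mul (hc.differentiable (by simp)),
    deriv_deriv_exp_mul_mul hy, deriv_exp_mul_mul (hy.differentiable (by simp))]
  simp only [radialOp, ← hs]
  have hexp := Real.exp_pos ((((n : ℝ) + 1) / 2 + s) * -Real.log ‖x‖)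
  generalize Real.exp ((((n : ℝ) + 1) / 2 + s) * -Real.log ‖x‖) = e at hexp ⊢
  field_simp
  ring

/-- A smooth monotone step, equal to `0` on `(-∞, 1]` and to `1` on `[2, ∞)`; its rescalings cut off
neighbourhoods of the boundary, of the origin and of infinity. -/
def cutoff (u : ℝ) : ℝ := Real.smoothTransition (u - 1)

theorem contDiff_cutoff {m : ℕ∞} : ContDiff ℝ m cutoff :=
  Real.smoothTransition.contDiff.comp (contDiff_id.sub contDiff_const)

theorem cutoff_of_le_one {u : ℝ} (hu : u ≤ 1) : cutoff u = 0 :=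
  Real.smoothTransition.zero_of_nonpos (by linarith)

theorem cutoff_of_two_le {u : ℝ} (hu : 2 ≤ u) : cutoff u = 1 :=
  Real.smoothTransition.one_of_one_le (by linarith)

theorem abs_cutoff_le_one (u : ℝ) : |cutoff u| ≤ 1 := by
  rw [cutoff, abs_of_nonneg (Real.smoothTransition.nonneg _)]
  exact Real.smoothTransition.le_one _

theorem deriv_cutoff_eq_zero {u : ℝ} (hu : u ∉ Icc 1 2) : deriv cutoff u = 0 := by
  rcases not_and_or.1 hu with hu | hu
  · have hzero : cutoff =ᶠ[𝓝 u] fun _ => 0 :=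
      (eventually_lt_nhds (not_le.1 hu)).mono fun _ hv => cutoff_of_le_one hv.le
    rw [hzero.deriv_eq, deriv_const]
  · have hone : cutoff =ᶠ[𝓝 u] fun _ => 1 :=
      (eventually_gt_nhds (not_le.1 hu)).mono fun _ hv => cutoff_of_two_le hv.le
    rw [hone.deriv_eq, deriv_const]

theorem hasCompactSupport_deriv_cutoff : HasCompactSupport (deriv cutoff) :=
  HasCompactSupport.intro isCompact_Icc fun _ hu => deriv_cutoff_eq_zero hu

theorem deriv_deriv_cutoff_eq_zero {u : ℝ} (hu : u ∉ Icc 1 2) : deriv (deriv cutoff) u = 0 := by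
  have hzero : deriv cutoff =ᶠ[𝓝 u] fun _ => 0 := by
    filter_upwards [isClosed_Icc.isOpen_compl.mem_nhds hu] with v hv using deriv_cutoff_eq_zero hv
  rw [hzero.deriv_eq, deriv_const]

theorem contDiff_deriv_cutoff {m : ℕ∞} : ContDiff ℝ m (deriv cutoff) :=
  (contDiff_infty_iff_deriv.1 (contDiff_cutoff (m := ⊤))).2.of_le (mod_cast le_top)

theorem continuous_deriv_deriv_cutoff : Continuous (deriv (deriv cutoff)) :=
  (contDiff_deriv_cutoff (m := 1)).continuous_deriv le_rfl

theorem exists_bound_mul_deriv_cutoff :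
    ∃ C, ∀ u, |u * deriv cutoff u| ≤ C ∧ |u ^ 2 * deriv (deriv cutoff) u| ≤ C := by
  have hfirst : HasCompactSupport fun u => u * deriv cutoff u :=
    hasCompactSupport_deriv_cutoff.mul_left
  have hsecond : HasCompactSupport fun u => u ^ 2 * deriv (deriv cutoff) u :=
    hasCompactSupport_deriv_cutoff.deriv.mul_left
  obtain ⟨C₁, hC₁⟩ := hfirst.exists_bound_of_continuous
    (continuous_id.mul (contDiff_deriv_cutoff (m := 0)).continuous)
  obtain ⟨C₂, hC₂⟩ := hsecond.exists_bound_of_continuous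
    ((continuous_pow 2).mul continuous_deriv_deriv_cutoff)
  exact ⟨max C₁ C₂, fun u => ⟨(hC₁ u).trans (le_max_left _ _), (hC₂ u).trans (le_max_right _ _)⟩⟩

theorem deriv_cutoff_mul (K : ℝ) :
    (deriv fun z => cutoff (K * z)) = fun z => K * deriv cutoff (K * z) := by
  ext z
  simp [deriv_comp_mul_left]

theorem deriv_deriv_cutoff_mul (K z : ℝ) :
    deriv (deriv fun z => cutoff (K * z)) z = K ^ 2 * deriv (deriv cutoff) (K * z) := by
  rw [deriv_cutoff_mul, deriv_const_mul_field, deriv_comp_mul_left, smul_eq_mul]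
  ring

theorem exists_forall_norm_gt_comp_neg_log_eq_zero {E : Type*} [NormedAddCommGroup E] {H : ℝ → ℝ}
    (hH : HasCompactSupport H) : ∃ b, ∀ x : E, b < ‖x‖ → H (-Real.log ‖x‖) = 0 := by
  obtain ⟨M, hM⟩ := hH.isCompact.bddBelow
  refine ⟨Real.exp (-M), fun x hx => ?_⟩
  by_contra hne
  have hlower : M ≤ -Real.log ‖x‖ := hM (subset_tsupport _ hne)
  have hlog := (Real.lt_log_iff_exp_lt ((Real.exp_pos _).trans hx)).2 hx
  linarith

theorem exists_forall_norm_lt_comp_neg_log_eq_zero {E : Type*} [NormedAddCommGroup E] {H : ℝ → ℝ}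
    {T : ℝ} (hH : ∀ t, T < t → H t = 0) :
    ∃ a, 0 < a ∧ ∀ x : E, x ≠ 0 → ‖x‖ < a → H (-Real.log ‖x‖) = 0 := by
  refine ⟨Real.exp (-T), Real.exp_pos _, fun x hx hxa => hH _ ?_⟩
  have := (Real.log_lt_iff_lt_exp (norm_pos_iff.2 hx)).2 hxa
  linarith

theorem integrableOn_mul_comp_neg_log_norm {E : Type*} [NormedAddCommGroup E] [ProperSpace E]
    [MeasurableSpace E] [BorelSpace E] {ν : Measure E} [IsFiniteMeasureOnCompacts ν] {f : E → ℝ}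
    {H : ℝ → ℝ} (hf : ContinuousOn f {0}ᶜ) (hH : Continuous H) (hHc : HasCompactSupport H) :
    IntegrableOn (fun x => f x * H (-Real.log ‖x‖)) {0}ᶜ ν := by
  obtain ⟨T, hT⟩ := hHc.isCompact.bddAbove
  obtain ⟨a, ha, hHa⟩ := exists_forall_norm_lt_comp_neg_log_eq_zero (E := E) (T := T)
    fun t ht => image_eq_zero_of_notMem_tsupport fun hmem => (hT hmem).not_gt ht
  obtain ⟨b, hHb⟩ := exists_forall_norm_gt_comp_neg_log_eq_zero (E := E) hHc
  have hannulus : IsCompact (Metric.closedBall (0 : E) b \ Metric.ball 0 a) :=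
    (isCompact_closedBall 0 b).diff Metric.isOpen_ball
  have hcont : ContinuousOn (fun x : E => f x * H (-Real.log ‖x‖)) {0}ᶜ :=
    hf.mul (hH.comp_continuousOn
      (continuous_norm.continuousOn.log fun x hx => norm_ne_zero_iff.2 hx).neg)
  have hsub : Metric.closedBall (0 : E) b \ Metric.ball 0 a ⊆ {0}ᶜ := by
    rintro _ hx rfl
    exact hx.2 (Metric.mem_ball_self ha)
  refine ((hcont.mono hsub).integrableOn_compact hannulus).of_forall_sdiff_eq_zero
    (measurableSet_singleton 0).compl fun x hx => ?_
  by_cases hxb : b < ‖x‖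
  · rw [hHb x hxb, mul_zero]
  · have hxa : ‖x‖ < a := by
      by_contra hax
      exact hx.2 ⟨by simpa using hxb, by simpa using hax⟩
    rw [hHa x hx.1 hxa, mul_zero]

theorem continuousOn_inv_norm_pow {E : Type*} [NormedAddCommGroup E] (k : ℕ) :
    ContinuousOn (fun x : E => (‖x‖ ^ k)⁻¹) {0}ᶜ :=
  (continuous_norm.pow k).continuousOn.inv₀ fun _ hx => pow_ne_zero _ (norm_ne_zero_iff.2 hx)

theorem halfSpace_subset_compl_zero (n : ℕ) : halfSpace n ⊆ {0}ᶜ :=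
  fun _ hx => ne_zero_of_mem_halfSpace hx

theorem integrableOn_logProfile {n k : ℕ} {y : ℝ → ℝ} (hy : Continuous y)
    (hyc : HasCompactSupport y) : IntegrableOn (logProfile n k y) (halfSpace n) := by
  have hcoord : ContinuousOn (fun x : Space n => x (Fin.last n) ^ 2) {0}ᶜ := by fun_prop
  refine ((integrableOn_mul_comp_neg_log_norm (hcoord.mul (continuousOn_inv_norm_pow k))
    hy hyc).mono_set (halfSpace_subset_compl_zero n)).congr_fun (fun x _ => ?_)
    (isOpen_halfSpace n).measurableSet
  simp only [logProfile, Pi.mul_apply, mul_assoc]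

theorem contDiff_cutoff_mul_logProfile {n k : ℕ} (K : ℝ) {y : ℝ → ℝ} (hy : ContDiff ℝ ∞ y) :
    ContDiff ℝ ∞ fun x : Space n => cutoff (K * x (Fin.last n)) * logProfile n k y x := by
  rw [contDiff_iff_contDiffAt]
  intro x
  rcases eq_or_ne x 0 with rfl | hx
  · have hnear : ∀ᶠ x : Space n in 𝓝 0, K * x (Fin.last n) < 1 := by
      refine ContinuousAt.eventually_lt (by fun_prop) continuousAt_const (by simp)
    refine contDiffAt_const (c := 0) |>.congr_of_eventuallyEq (hnear.mono fun x hx => ?_)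
    simp only [cutoff_of_le_one hx.le, zero_mul]
  · have hz := contDiffAt_lastCoord (m := ∞) x
    exact (contDiff_cutoff.contDiffAt.comp x (contDiffAt_const.mul hz)).mul ((hz.pow 2).mul
      ((((contDiffAt_norm ℝ hx).pow k).inv (pow_ne_zero _ (norm_ne_zero_iff.2 hx))).mul
        (hy.contDiffAt.comp x (contDiffAt_neg_log_norm hx))))

theorem hasCompactSupport_logProfile {n k : ℕ} {y : ℝ → ℝ} (hyc : HasCompactSupport y) :
    HasCompactSupport (logProfile n k y) := by
  obtain ⟨b, hb⟩ := exists_forall_norm_gt_comp_neg_log_eq_zero (E := Space n) hyc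
  refine HasCompactSupport.intro (isCompact_closedBall 0 b) fun x hx => ?_
  rw [logProfile, hb x (by simpa using hx), mul_zero, mul_zero]

theorem tsupport_cutoff_mul_subset_halfSpace {n : ℕ} {K : ℝ} (hK : 0 < K) (f : Space n → ℝ) :
    tsupport (fun x : Space n => cutoff (K * x (Fin.last n)) * f x) ⊆ halfSpace n := by
  have hclosed : IsClosed {x : Space n | 1 ≤ K * x (Fin.last n)} :=
    isClosed_le continuous_const (by fun_prop)
  have hsupport : Function.support (fun x : Space n => cutoff (K * x (Fin.last n)) * f x) ⊆
      {x | 1 ≤ K * x (Fin.last n)} := by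
    intro x hx
    by_contra hlt
    exact hx (by simp only [cutoff_of_le_one (not_le.1 hlt).le, zero_mul])
  intro x hx
  have hone : 1 ≤ K * x (Fin.last n) := closure_minimal hsupport hclosed hx
  exact pos_of_mul_pos_right (zero_lt_one.trans_le hone) hK.le

theorem abs_lastCoord_le_norm {n : ℕ} (x : Space n) : |x (Fin.last n)| ≤ ‖x‖ := by
  simpa using PiLp.norm_apply_le x (Fin.last n)

theorem lastCoord_sq_div_norm_sq_le_one {n : ℕ} (x : Space n) :
    x (Fin.last n) ^ 2 / ‖x‖ ^ 2 ≤ 1 :=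
  div_le_one_of_le₀ (sq_le_sq' (neg_le_of_abs_le (abs_lastCoord_le_norm x))
    (le_of_abs_le (abs_lastCoord_le_norm x))) (by positivity)

theorem exists_bound_cutoffCommutator (n : ℕ) (s : ℝ) {y : ℝ → ℝ} (hy : ContDiff ℝ ∞ y)
    (hyc : HasCompactSupport y) :
    ∃ H : ℝ → ℝ, Continuous H ∧ HasCompactSupport H ∧ ∀ (K : ℝ) (x : Space n),
      |cutoffCommutator n s (fun z => cutoff (K * z)) y x| ≤
        (‖x‖ ^ (n + 1))⁻¹ * H (-Real.log ‖x‖) := by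
  obtain ⟨C, hC⟩ := exists_bound_mul_deriv_cutoff
  have hdy : Continuous (deriv y) := hy.continuous_deriv (by simp)
  refine ⟨fun t => 2 * C * |deriv y t + (((n : ℝ) + 1) / 2 + s) * y t| + 3 * C * |y t|,
    by fun_prop, ?_, fun K x => ?_⟩
  · refine HasCompactSupport.intro hyc.isCompact fun t ht => ?_
    rw [image_eq_zero_of_notMem_tsupport ht,
      image_eq_zero_of_notMem_tsupport fun h => ht (tsupport_deriv_subset h)]
    simp
  · set z := x (Fin.last n)
    set v := y (-Real.log ‖x‖)
    set w := deriv y (-Real.log ‖x‖) + (((n : ℝ) + 1) / 2 + s) * v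
    -- `c(Kz)` is a function of `Kz`, so the Euler derivatives `z c'` and `z² c''` do not see `K`.
    obtain ⟨hfirst, hsecond⟩ := hC (K * z)
    have hz := lastCoord_sq_div_norm_sq_le_one x
    rw [cutoffCommutator, deriv_deriv_cutoff_mul, deriv_cutoff_mul, abs_mul,
      abs_of_nonneg (by positivity)]
    gcongr
    calc |2 * (z ^ 2 / ‖x‖ ^ 2) * (z * (K * deriv cutoff (K * z))) * w -
            (2 * (z * (K * deriv cutoff (K * z))) +
              z ^ 2 * (K ^ 2 * deriv (deriv cutoff) (K * z))) * v|
        = |2 * (z ^ 2 / ‖x‖ ^ 2) * (K * z * deriv cutoff (K * z)) * w -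
            (2 * (K * z * deriv cutoff (K * z)) +
              (K * z) ^ 2 * deriv (deriv cutoff) (K * z)) * v| := by ring_nf
      _ ≤ 2 * (z ^ 2 / ‖x‖ ^ 2) * |K * z * deriv cutoff (K * z)| * |w| +
            (2 * |K * z * deriv cutoff (K * z)| +
              |(K * z) ^ 2 * deriv (deriv cutoff) (K * z)|) * |v| := by
        refine (abs_sub _ _).trans ?_
        simp only [abs_mul _ w, abs_mul _ v]
        gcongr
        · rw [abs_mul, abs_of_nonneg (by positivity : 0 ≤ 2 * (z ^ 2 / ‖x‖ ^ 2))]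
        · refine (abs_add_le _ _).trans_eq ?_
          rw [abs_mul 2, abs_two]
      _ ≤ 2 * 1 * C * |w| + (2 * C + C) * |v| := by gcongr
      _ = 2 * C * |w| + 3 * C * |v| := by ring

theorem cutoffCommutator_cutoff_eq_zero {n : ℕ} (s : ℝ) {K : ℝ} (y : ℝ → ℝ) {x : Space n}
    (hK : 2 < K * x (Fin.last n)) : cutoffCommutator n s (fun z => cutoff (K * z)) y x = 0 := by
  have hmem : K * x (Fin.last n) ∉ Icc 1 2 := fun h => h.2.not_gt hK
  rw [cutoffCommutator, deriv_deriv_cutoff_mul, deriv_cutoff_mul]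
  simp only [deriv_cutoff_eq_zero hmem, deriv_deriv_cutoff_eq_zero hmem]
  ring

theorem eventually_two_lt_mul_lastCoord {n : ℕ} {x : Space n} (hx : x ∈ halfSpace n) :
    ∀ᶠ K in atTop, 2 < K * x (Fin.last n) :=
  (tendsto_id.atTop_mul_const hx).eventually_gt_atTop 2

theorem measurable_lastCoord (n : ℕ) : Measurable fun x : Space n => x (Fin.last n) :=
  Continuous.measurable (by fun_prop)

theorem measurable_logProfile (n k : ℕ) {y : ℝ → ℝ} (hy : Measurable y) :
    Measurable (logProfile n k y) := by
  have := measurable_lastCoord n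
  unfold logProfile
  fun_prop

theorem measurable_cutoffCommutator (n : ℕ) (s : ℝ) {c y : ℝ → ℝ} (hy : Measurable y) :
    Measurable (cutoffCommutator n s c y) := by
  have hz := measurable_lastCoord n
  have hτ : Measurable fun x : Space n => -Real.log ‖x‖ := by fun_prop
  have hdc := (measurable_deriv c).comp hz
  have hddc := (measurable_deriv (deriv c)).comp hz
  have hdy := (measurable_deriv y).comp hτ
  simp only [Function.comp_def] at hdc hddc hdy
  unfold cutoffCommutator
  fun_prop

theorem integrable_lastCoord_mul_inv_norm_pow_mul {n : ℕ} {ν : Measure (Space n)} {y : ℝ → ℝ}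
    (hym : Measurable y) (hy : Integrable (fun x : Space n => (‖x‖ ^ n)⁻¹ * y (-Real.log ‖x‖)) ν) :
    Integrable (fun x : Space n =>
      x (Fin.last n) * ((‖x‖ ^ (n + 1))⁻¹ * y (-Real.log ‖x‖))) ν := by
  refine hy.mono (Measurable.aestronglyMeasurable (by fun_prop)) (.of_forall fun x => ?_)
  rw [pow_succ, mul_inv_rev, mul_assoc, ← mul_assoc, norm_mul]
  refine mul_le_of_le_one_left (norm_nonneg _) ?_
  rw [← div_eq_mul_inv, norm_div, norm_norm]
  exact div_le_one_of_le₀ (abs_lastCoord_le_norm x) (norm_nonneg x)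

theorem integrable_mul_logProfile {n : ℕ} {ν : Measure (Space n)} {g : Space n → ℝ} {y : ℝ → ℝ}
    (hg : MemLp (fun x => rho n x * g x) ⊤ ν) (hym : Measurable y)
    (hy : Integrable (fun x : Space n => (‖x‖ ^ n)⁻¹ * y (-Real.log ‖x‖)) ν) :
    Integrable (fun x => g x * logProfile n (n + 1) y x) ν := by
  refine ((integrable_lastCoord_mul_inv_norm_pow_mul hym hy).mul_of_top_right hg).congr
    (.of_forall fun x => ?_)
  simp only [Pi.mul_apply, rho, logProfile]
  ring

theorem tendsto_integral_mul_cutoff_mul {n : ℕ} {f : Space n → ℝ}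
    (hf : IntegrableOn f (halfSpace n)) :
    Tendsto (fun K => ∫ x in halfSpace n, cutoff (K * x (Fin.last n)) * f x) atTop
      (𝓝 (∫ x in halfSpace n, f x)) := by
  have hz := measurable_lastCoord n
  have hcut : Measurable cutoff := (contDiff_cutoff (m := 0)).continuous.measurable
  refine tendsto_integral_filter_of_dominated_convergence (fun x => |f x|)
    (.of_forall fun K => ?_) (.of_forall fun K => .of_forall fun x => ?_) hf.abs ?_
  · exact (hcut.comp (hz.const_mul K)).aestronglyMeasurable.mul hf.aestronglyMeasurable
  · rw [norm_mul, Real.norm_eq_abs]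
    exact mul_le_of_le_one_left (abs_nonneg _) (abs_cutoff_le_one _)
  · filter_upwards [ae_restrict_mem (isOpen_halfSpace n).measurableSet] with x hx
    refine tendsto_const_nhds.congr' ?_
    filter_upwards [eventually_two_lt_mul_lastCoord hx] with K hK
    rw [cutoff_of_two_le hK.le, one_mul]

theorem integrableOn_inv_norm_pow_mul (n k : ℕ) {H : ℝ → ℝ} (hH : Continuous H)
    (hHc : HasCompactSupport H) :
    IntegrableOn (fun x : Space n => (‖x‖ ^ k)⁻¹ * H (-Real.log ‖x‖)) (halfSpace n) :=
  (integrableOn_mul_comp_neg_log_norm (continuousOn_inv_norm_pow k) hH hHc).mono_set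
    (halfSpace_subset_compl_zero n)

theorem integrableOn_cutoffCommutator (n : ℕ) (s K : ℝ) {y : ℝ → ℝ} (hy : ContDiff ℝ ∞ y)
    (hyc : HasCompactSupport y) :
    IntegrableOn (cutoffCommutator n s (fun z => cutoff (K * z)) y) (halfSpace n) := by
  obtain ⟨H, hH, hHc, hbound⟩ := exists_bound_cutoffCommutator n s hy hyc
  exact (integrableOn_inv_norm_pow_mul n (n + 1) hH hHc).mono'
    (measurable_cutoffCommutator n s hy.continuous.measurable).aestronglyMeasurable
    (.of_forall (hbound K))

theorem tendsto_integral_mul_cutoffCommutator {n : ℕ} (s : ℝ) {ζ : Space n → ℝ} {y : ℝ → ℝ}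
    (hζ : MemLp ζ ⊤ (volume.restrict (halfSpace n))) (hy : ContDiff ℝ ∞ y)
    (hyc : HasCompactSupport y) :
    Tendsto (fun K => ∫ x in halfSpace n,
      ζ x * cutoffCommutator n s (fun z => cutoff (K * z)) y x) atTop (𝓝 0) := by
  obtain ⟨H, hH, hHc, hbound⟩ := exists_bound_cutoffCommutator n s hy hyc
  rw [← integral_zero (Space n) ℝ (μ := volume.restrict (halfSpace n))]
  refine tendsto_integral_filter_of_dominated_convergence
    (fun x => |ζ x| * ((‖x‖ ^ (n + 1))⁻¹ * H (-Real.log ‖x‖)))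
    (.of_forall fun K => ?_) (.of_forall fun K => .of_forall fun x => ?_) ?_ ?_
  · exact hζ.1.mul (measurable_cutoffCommutator n s hy.continuous.measurable).aestronglyMeasurable
  · rw [norm_mul, Real.norm_eq_abs, Real.norm_eq_abs]
    exact mul_le_mul_of_nonneg_left (hbound K x) (abs_nonneg _)
  · exact (integrableOn_inv_norm_pow_mul n (n + 1) hH hHc).mul_of_top_right hζ.abs
  · filter_upwards [ae_restrict_mem (isOpen_halfSpace n).measurableSet] with x hx
    refine tendsto_const_nhds.congr' ?_
    filter_upwards [eventually_two_lt_mul_lastCoord hx] with K hK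
    rw [cutoffCommutator_cutoff_eq_zero s y hK, mul_zero]

theorem radialOp_congr_nhds {s t : ℝ} {y y' : ℝ → ℝ} (h : y =ᶠ[𝓝 t] y') :
    radialOp s y t = radialOp s y' t := by
  rw [radialOp, radialOp, h.deriv.deriv_eq, h.deriv_eq]

theorem continuous_radialOp (s : ℝ) {y : ℝ → ℝ} (hy : ContDiff ℝ 2 y) :
    Continuous (radialOp s y) := by
  have hdy : ContDiff ℝ 1 (deriv y) := (contDiff_succ_iff_deriv.1 hy).2.2
  have hdyc := hdy.continuous
  unfold radialOp
  fun_prop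

theorem hasCompactSupport_radialOp (s : ℝ) {y : ℝ → ℝ} (hyc : HasCompactSupport y) :
    HasCompactSupport (radialOp s y) := by
  refine HasCompactSupport.intro hyc.isCompact fun t ht => ?_
  rw [radialOp_congr_nhds (notMem_tsupport_iff_eventuallyEq.1 ht)]
  simp [radialOp, Pi.zero_def]

theorem integral_smul_eq_setIntegral_of_tsupport_subset {α : Type*} [TopologicalSpace α]
    [MeasurableSpace α] {ν : Measure α} {s : Set α} {ξ : α → ℝ} (hξ : tsupport ξ ⊆ s)
    (g : α → ℝ) : ∫ x, ξ x • g x ∂ν = ∫ x in s, g x * ξ x ∂ν := by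
  rw [← setIntegral_eq_integral_of_forall_compl_eq_zero (s := s)]
  · simp only [smul_eq_mul, mul_comm]
  · intro x hx
    rw [image_eq_zero_of_notMem_tsupport fun h => hx (hξ h), zero_smul]

namespace IsDualOf

variable {n : ℕ} {μ : ℝ} {ζ g : Space n → ℝ}

theorem integrableOn_mul (hg : IsDualOf n μ ζ g) {ξ : Space n → ℝ} (hξ : Continuous ξ)
    (hξc : HasCompactSupport ξ) (hξs : tsupport ξ ⊆ halfSpace n) :
    IntegrableOn (fun x => g x * ξ x) (halfSpace n) := by
  have hsupport : IntegrableOn (fun x => g x * ξ x) (tsupport ξ) :=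
    (hg.1.integrableOn_compact_subset hξs hξc).mul_continuousOn hξ.continuousOn hξc
  exact ((integrableOn_iff_integrable_of_support_subset
    ((Function.support_mul_subset_right _ _).trans (subset_tsupport ξ))).1 hsupport).integrableOn

theorem ae_eq {g' : Space n → ℝ} (hg : IsDualOf n μ ζ g) (hg' : IsDualOf n μ ζ g') :
    g =ᵐ[volume.restrict (halfSpace n)] g' := by
  have hzero := (isOpen_halfSpace n).ae_eq_zero_of_integral_contDiff_smul_eq_zero (hg.1.sub hg'.1)
    fun ξ hξ hξc hξs => by
      rw [integral_smul_eq_setIntegral_of_tsupport_subset hξs]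
      simp only [Pi.sub_apply, sub_mul]
      rw [integral_sub (hg.integrableOn_mul hξ.continuous hξc hξs)
        (hg'.integrableOn_mul hξ.continuous hξc hξs), ← hg.2 ξ hξ hξc hξs, ← hg'.2 ξ hξ hξc hξs,
        sub_self]
  rw [EventuallyEq, ae_restrict_iff' (isOpen_halfSpace n).measurableSet]
  filter_upwards [hzero] with x hx hxH using sub_eq_zero.1 (hx hxH)

theorem ae_eq_zero_of_isOpen (hg : IsDualOf n μ ζ g) {U : Set (Space n)} (hU : IsOpen U)
    (hζ : ∀ᵐ x ∂volume.restrict (halfSpace n), x ∈ U → ζ x = 0) :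
    ∀ᵐ x ∂volume.restrict (halfSpace n), x ∈ U → g x = 0 := by
  have hzero := ((isOpen_halfSpace n).inter hU).ae_eq_zero_of_integral_contDiff_smul_eq_zero
    (hg.1.mono_set inter_subset_left) fun ξ hξ hξc hξs => by
      have hξH := hξs.trans inter_subset_left
      rw [integral_smul_eq_setIntegral_of_tsupport_subset hξH, ← hg.2 ξ hξ hξc hξH]
      refine integral_eq_zero_of_ae (hζ.mono fun x hx => ?_)
      by_cases hxs : x ∈ tsupport ξ
      · simp only [hx (hξs hxs).2, zero_mul, Pi.zero_apply]
      · simp only [dualTranspose_eq_zero_of_notMem_tsupport hxs, mul_zero, Pi.zero_apply]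
  rw [ae_restrict_iff' (isOpen_halfSpace n).measurableSet]
  filter_upwards [hzero] with x hx hxH hxU using hx ⟨hxH, hxU⟩

theorem setIntegral_mul_cutoff_mul_logProfile (hg : IsDualOf n μ ζ g)
    (hζ : MemLp ζ ⊤ (volume.restrict (halfSpace n))) {y : ℝ → ℝ} (hy : ContDiff ℝ ∞ y)
    (hyc : HasCompactSupport y) {K : ℝ} (hK : 0 < K) :
    ∫ x in halfSpace n, cutoff (K * x (Fin.last n)) * (g x * logProfile n (n + 1) y x) =
      (∫ x in halfSpace n, cutoff (K * x (Fin.last n)) *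
        (ζ x * logProfile n (n + 3) (radialOp √(μ - muOne n) y) x)) +
      ∫ x in halfSpace n,
        ζ x * cutoffCommutator n √(μ - muOne n) (fun z => cutoff (K * z)) y x := by
  set s := √(μ - muOne n)
  have hy2 : ContDiff ℝ 2 y := hy.of_le ENat.LEInfty.out
  have hcut : ContDiff ℝ 2 fun z => cutoff (K * z) :=
    (contDiff_cutoff (m := 2)).comp (contDiff_const.mul contDiff_id)
  have hweak := hg.2 _ (contDiff_cutoff_mul_logProfile K hy)
    (hasCompactSupport_logProfile hyc).mul_left
    (tsupport_cutoff_mul_subset_halfSpace hK (logProfile n (n + 1) y))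
  have hcutm : Measurable fun x : Space n => cutoff (K * x (Fin.last n)) :=
    hcut.continuous.measurable.comp (measurable_lastCoord n)
  have hmain : IntegrableOn (fun x => cutoff (K * x (Fin.last n)) *
      (ζ x * logProfile n (n + 3) (radialOp s y) x)) (halfSpace n) :=
    ((integrableOn_logProfile (continuous_radialOp s hy2)
      (hasCompactSupport_radialOp s hyc)).mul_of_top_right hζ).bdd_mul
      hcutm.aestronglyMeasurable (.of_forall fun x => abs_cutoff_le_one _)
  have hcomm : IntegrableOn (fun x => ζ x * cutoffCommutator n s (fun z => cutoff (K * z)) y x)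
      (halfSpace n) := (integrableOn_cutoffCommutator n s K hy hyc).mul_of_top_right hζ
  rw [← integral_add hmain hcomm]
  calc ∫ x in halfSpace n, cutoff (K * x (Fin.last n)) * (g x * logProfile n (n + 1) y x)
      = ∫ x in halfSpace n, g x * (cutoff (K * x (Fin.last n)) * logProfile n (n + 1) y x) := by
        simp only [mul_left_comm]
    _ = _ := by
        rw [← hweak]
        refine setIntegral_congr_fun (isOpen_halfSpace n).measurableSet fun x hx => ?_
        simp only [dualTranspose_mul_logProfile μ hcut hy2 hx, s]
        ring

theorem setIntegral_mul_logProfile (hg : IsDualOf n μ ζ g)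
    (hζ : MemLp ζ ⊤ (volume.restrict (halfSpace n)))
    (hρg : MemLp (fun x => rho n x * g x) ⊤ (volume.restrict (halfSpace n))) {y : ℝ → ℝ}
    (hy : ContDiff ℝ ∞ y) (hyc : HasCompactSupport y) :
    ∫ x in halfSpace n, g x * logProfile n (n + 1) y x =
      ∫ x in halfSpace n, ζ x * logProfile n (n + 3) (radialOp √(μ - muOne n) y) x := by
  set s := √(μ - muOne n)
  have hleft := tendsto_integral_mul_cutoff_mul (integrable_mul_logProfile hρg
    hy.continuous.measurable (integrableOn_inv_norm_pow_mul n n hy.continuous hyc))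
  have hright : IntegrableOn (fun x => ζ x * logProfile n (n + 3) (radialOp s y) x)
      (halfSpace n) :=
    (integrableOn_logProfile (continuous_radialOp s (hy.of_le ENat.LEInfty.out))
      (hasCompactSupport_radialOp s hyc)).mul_of_top_right hζ
  have hsum := (tendsto_integral_mul_cutoff_mul hright).add
    (tendsto_integral_mul_cutoffCommutator s hζ hy hyc)
  rw [add_zero] at hsum
  refine tendsto_nhds_unique hleft (hsum.congr' ?_)
  filter_upwards [eventually_gt_atTop 0] with K hK using
    (hg.setIntegral_mul_cutoff_mul_logProfile hζ hy hyc hK).symm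

theorem setIntegral_mul_logProfile_of_eq_zero (hg : IsDualOf n μ ζ g)
    (hζ : MemLp ζ ⊤ (volume.restrict (halfSpace n)))
    (hρg : MemLp (fun x => rho n x * g x) ⊤ (volume.restrict (halfSpace n))) {R T : ℝ}
    (hR : ∀ᵐ x ∂volume.restrict (halfSpace n), R < ‖x‖ → ζ x = 0) {y : ℝ → ℝ}
    (hy : ContDiff ℝ ∞ y) (hyT : ∀ t, T < t → y t = 0) :
    ∫ x in halfSpace n, g x * logProfile n (n + 1) y x =
      ∫ x in halfSpace n, ζ x * logProfile n (n + 3) (radialOp √(μ - muOne n) y) x := by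
  set M := 3 + Real.log (max R 1)
  set yM : ℝ → ℝ := fun t => cutoff (t + M) * y t
  have hyM : ContDiff ℝ ∞ yM := (contDiff_cutoff.comp (contDiff_id.add contDiff_const)).mul hy
  have hyMc : HasCompactSupport yM := by
    refine HasCompactSupport.intro (isCompact_Icc (a := 1 - M) (b := T)) fun t ht => ?_
    rcases not_and_or.1 ht with ht | ht
    · simp only [yM, cutoff_of_le_one (show t + M ≤ 1 by linarith), zero_mul]
    · simp only [yM, hyT t (not_le.1 ht), mul_zero]
  have heq {x : Space n} (hx : x ∈ halfSpace n) (hxR : ¬ R < ‖x‖) : yM =ᶠ[𝓝 (-Real.log ‖x‖)] y := by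
    have hlog : Real.log ‖x‖ ≤ Real.log (max R 1) :=
      Real.log_le_log (norm_pos_of_mem_halfSpace hx) ((not_lt.1 hxR).trans (le_max_left _ _))
    have hlower : 2 - M < -Real.log ‖x‖ := by linarith
    filter_upwards [eventually_gt_nhds hlower] with t ht
    simp only [yM, cutoff_of_two_le (show 2 ≤ t + M by linarith), one_mul]
  have hmem := ae_restrict_mem (μ := volume) (isOpen_halfSpace n).measurableSet
  have hleft : ∫ x in halfSpace n, g x * logProfile n (n + 1) y x =
      ∫ x in halfSpace n, g x * logProfile n (n + 1) yM x := by
    refine integral_congr_ae ?_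
    filter_upwards [hg.ae_eq_zero_of_isOpen (isOpen_lt continuous_const continuous_norm) hR, hmem]
      with x hgx hx
    by_cases hxR : R < ‖x‖
    · simp only [hgx hxR, zero_mul]
    · simp only [logProfile, (heq hx hxR).eq_of_nhds]
  have hright : ∫ x in halfSpace n, ζ x * logProfile n (n + 3) (radialOp √(μ - muOne n) yM) x =
      ∫ x in halfSpace n, ζ x * logProfile n (n + 3) (radialOp √(μ - muOne n) y) x := by
    refine integral_congr_ae ?_
    filter_upwards [hR, hmem] with x hζx hx
    by_cases hxR : R < ‖x‖
    · simp only [hζx hxR, zero_mul]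
    · simp only [logProfile, radialOp_congr_nhds (heq hx hxR)]
  rw [hleft, ← hright]
  exact hg.setIntegral_mul_logProfile hζ hρg hyM hyMc

end IsDualOf

theorem integral_mul_comp_norm {E : Type*} [NormedAddCommGroup E] [NormedSpace ℝ E]
    [FiniteDimensional ℝ E] [Nontrivial E] [MeasurableSpace E] [BorelSpace E] (ν : Measure E)
    [ν.IsAddHaarMeasure] (f : E → ℝ) (h : ℝ → ℝ) :
    ∫ x, f (‖x‖⁻¹ • x) * h ‖x‖ ∂ν =
      (∫ σ, f (σ : E) ∂ν.toSphere) * ∫ r in Ioi 0, r ^ (Module.finrank ℝ E - 1) * h r := by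
  set d := Module.finrank ℝ E - 1
  have hradial : ∫ r, h (r : ℝ) ∂(Measure.volumeIoiPow d) = ∫ r in Ioi 0, r ^ d * h r := by
    simp only [Measure.volumeIoiPow, ENNReal.ofReal]
    rw [integral_withDensity_eq_integral_smul
        (measurable_subtype_coe.pow_const _).real_toNNReal,
      integral_subtype_comap measurableSet_Ioi fun r => Real.toNNReal (r ^ d) • h r]
    refine setIntegral_congr_fun measurableSet_Ioi fun r hr => ?_
    rw [NNReal.smul_def, Real.coe_toNNReal _ (pow_nonneg (le_of_lt hr) d), smul_eq_mul]
  calc ∫ x, f (‖x‖⁻¹ • x) * h ‖x‖ ∂ν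
      = ∫ x : ({0}ᶜ : Set E), f (‖(x : E)‖⁻¹ • (x : E)) * h ‖(x : E)‖ ∂ν.comap (↑) := by
        rw [integral_subtype_comap (measurableSet_singleton _).compl
          fun x : E => f (‖x‖⁻¹ • x) * h ‖x‖, restrict_compl_singleton]
    _ = ∫ q, f (q.1 : E) * h q.2 ∂ν.toSphere.prod (.volumeIoiPow d) := by
        simpa using ν.measurePreserving_homeomorphUnitSphereProd.integral_comp
          (Homeomorph.measurableEmbedding _)
          fun q : Metric.sphere (0 : E) 1 × Ioi (0 : ℝ) => f (q.1 : E) * h q.2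
    _ = _ := by
        rw [integral_prod_mul (fun σ : Metric.sphere (0 : E) 1 => f σ)
          fun r : Ioi (0 : ℝ) => h r, hradial]

theorem integral_Ioi_inv_mul_comp_neg_log (Q : ℝ → ℝ) :
    ∫ r in Ioi 0, r⁻¹ * Q (-Real.log r) = ∫ t, Q t := by
  rw [← Real.range_exp, ← image_univ, integral_image_eq_integral_abs_deriv_smul MeasurableSet.univ
    (fun t _ => (Real.hasDerivAt_exp t).hasDerivWithinAt) Real.exp_injective.injOn,
    setIntegral_univ, ← integral_neg_eq_self Q]
  refine integral_congr_ae (.of_forall fun t => ?_)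
  simp [(Real.exp_pos t).ne']

theorem setIntegral_logProfile (n : ℕ) (Q : ℝ → ℝ) :
    ∫ x in halfSpace n, logProfile n (n + 3) Q x = psiOneSqIntegral n * ∫ t, Q t := by
  have hH := (isOpen_halfSpace n).measurableSet
  have hmem {x : Space n} (hx : x ≠ 0) : ‖x‖⁻¹ • x ∈ halfSpace n ↔ x ∈ halfSpace n :=
    mul_pos_iff_of_pos_left (inv_pos.2 (norm_pos_iff.2 hx))
  have hpolar : (halfSpace n).indicator (logProfile n (n + 3) Q) =ᵐ[volume] fun x =>
      (halfSpace n).indicator (fun x => psiOne n x ^ 2) (‖x‖⁻¹ • x) *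
        ((‖x‖ ^ (n + 1))⁻¹ * Q (-Real.log ‖x‖)) := by
    filter_upwards [compl_mem_ae_iff.2 (measure_singleton 0)] with x hx
    have hnorm := norm_ne_zero_iff.2 hx
    by_cases hxH : x ∈ halfSpace n
    · rw [indicator_of_mem hxH, indicator_of_mem ((hmem hx).2 hxH), logProfile, psiOne, norm_smul,
        PiLp.smul_apply, smul_eq_mul, norm_inv, norm_norm]
      field_simp
      ring
    · rw [indicator_of_notMem hxH, indicator_of_notMem (mt (hmem hx).1 hxH), zero_mul]
  have hsphere : ∫ σ, (halfSpace n).indicator (fun x => psiOne n x ^ 2) (σ : Space n)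
      ∂(volume : Measure (Space n)).toSphere = psiOneSqIntegral n :=
    integral_indicator (measurable_subtype_coe hH)
  rw [← integral_indicator hH, integral_congr_ae hpolar,
    integral_mul_comp_norm volume _ fun r => (r ^ (n + 1))⁻¹ * Q (-Real.log r), hsphere,
    ← integral_Ioi_inv_mul_comp_neg_log, finrank_euclideanSpace_fin, Nat.add_sub_cancel]
  congr 1
  refine setIntegral_congr_fun measurableSet_Ioi fun r hr => ?_
  have hr0 : r ≠ 0 := ne_of_gt hr
  field_simp
  ring

theorem tendsto_integral_mul_of_concentrating {α ι : Type*} [MeasurableSpace α] {ν : Measure α}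
    {l : Filter α} {l' : Filter ι} {ζ : α → ℝ} {W : ι → α → ℝ} {z c D : ℝ}
    (hζ : MemLp ζ ⊤ ν) (hz : Tendsto ζ l (𝓝 z)) (hW : ∀ᶠ i in l', Integrable (W i) ν)
    (hD : ∀ᶠ i in l', ∫ x, |W i x| ∂ν ≤ D) (hc : ∀ᶠ i in l', ∫ x, W i x ∂ν = c)
    (hconc : ∀ S ∈ l, ∀ᶠ i in l', ∀ᵐ x ∂ν, x ∉ S → W i x = 0) :
    Tendsto (fun i => ∫ x, ζ x * W i x ∂ν) l' (𝓝 (z * c)) := by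
  refine Metric.tendsto_nhds.2 fun ε hε => ?_
  have hδ : 0 < ε / (|D| + 1) := by positivity
  filter_upwards [hW, hD, hc, hconc _ (Metric.tendsto_nhds.1 hz _ hδ)] with i hWi hDi hci hi
  have hprod : Integrable (fun x => ζ x * W i x) ν := hWi.mul_of_top_right hζ
  have hsmall : ∀ᵐ x ∂ν, ‖ζ x * W i x - z * W i x‖ ≤ ε / (|D| + 1) * |W i x| := by
    filter_upwards [hi] with x hx
    rw [← sub_mul, norm_mul, ← dist_eq_norm, Real.norm_eq_abs]
    by_cases hxS : dist (ζ x) z < ε / (|D| + 1)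
    · gcongr
    · rw [hx hxS, abs_zero, mul_zero, mul_zero]
  rw [Real.dist_eq, ← hci, ← integral_const_mul, ← integral_sub hprod (hWi.const_mul z)]
  calc |∫ x, ζ x * W i x - z * W i x ∂ν|
      ≤ ∫ x, ε / (|D| + 1) * |W i x| ∂ν := norm_integral_le_of_norm_le (hWi.abs.const_mul _) hsmall
    _ = ε / (|D| + 1) * ∫ x, |W i x| ∂ν := integral_const_mul _ _
    _ ≤ ε / (|D| + 1) * |D| := by
        gcongr
        exact hDi.trans (le_abs_self D)
    _ < ε := by
        rw [div_mul_eq_mul_div, div_lt_iff₀ (by positivity)]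
        nlinarith

/-- The affine function `A + B t`, cut off smoothly on `[T, 2T]` so as to vanish for `t ≥ 2T`. -/
def truncAffine (A B T t : ℝ) : ℝ := (A + B * t) * (1 - cutoff (T⁻¹ * t))

theorem contDiff_truncAffine (A B T : ℝ) : ContDiff ℝ ∞ (truncAffine A B T) :=
  (contDiff_const.add (contDiff_const.mul contDiff_id)).mul
    (contDiff_const.sub (contDiff_cutoff.comp (contDiff_const.mul contDiff_id)))

theorem truncAffine_eq_zero (A B : ℝ) {T t : ℝ} (hT : 0 < T) (ht : 2 * T < t) :
    truncAffine A B T t = 0 := by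
  have htwo : 2 ≤ T⁻¹ * t := by
    rw [inv_mul_eq_div]
    exact (le_div_iff₀ hT).2 ht.le
  rw [truncAffine, cutoff_of_two_le htwo, sub_self, mul_zero]

theorem truncAffine_eq_affine (A B : ℝ) {T t : ℝ} (hT : 0 < T) (ht : t ≤ T) :
    truncAffine A B T t = A + B * t := by
  have hone : T⁻¹ * t ≤ 1 := by
    rw [inv_mul_eq_div]
    exact (div_le_one hT).2 ht
  rw [truncAffine, cutoff_of_le_one hone, sub_zero, mul_one]

theorem abs_truncAffine_le (A B T t : ℝ) : |truncAffine A B T t| ≤ |A + B * t| := by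
  rw [truncAffine, abs_mul]
  refine mul_le_of_le_one_right (abs_nonneg _) ?_
  rw [cutoff, abs_of_nonneg (sub_nonneg.2 (Real.smoothTransition.le_one _))]
  exact sub_le_self _ (Real.smoothTransition.nonneg _)

theorem hasDerivAt_affine (A B t : ℝ) : HasDerivAt (fun t => A + B * t) B t := by
  simpa using ((hasDerivAt_id t).const_mul B).const_add A

theorem hasDerivAt_affine_mul_one_sub (A B : ℝ) {c : ℝ → ℝ} {c' t : ℝ} (hc : HasDerivAt c c' t) :
    HasDerivAt (fun t => (A + B * t) * (1 - c t)) (B * (1 - c t) - (A + B * t) * c') t :=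
  ((hasDerivAt_affine A B t).fun_mul (hc.const_sub 1)).congr_deriv (by ring)

theorem radialOp_affine_mul_one_sub {s A B : ℝ} (hsB : s * B = 0) {c : ℝ → ℝ}
    (hc : ContDiff ℝ 2 c) (t : ℝ) :
    radialOp s (fun t => (A + B * t) * (1 - c t)) t =
      2 * (B + s * A) * deriv c t + (A + B * t) * deriv (deriv c) t := by
  have hc' (t : ℝ) : HasDerivAt c (deriv c t) t := (hc.differentiable (by simp) t).hasDerivAt
  have hc'' : HasDerivAt (deriv c) (deriv (deriv c) t) t :=
    (hc.differentiable_deriv_two t).hasDerivAt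
  have hfirst : (deriv fun t => (A + B * t) * (1 - c t)) =
      fun t => B * (1 - c t) - (A + B * t) * deriv c t :=
    funext fun t => (hasDerivAt_affine_mul_one_sub A B (hc' t)).deriv
  have hsecond := (((hc' t).const_sub 1).const_mul B).fun_sub
    ((hasDerivAt_affine A B t).fun_mul hc'')
  rw [radialOp, hfirst, hsecond.deriv]
  linear_combination (-2 * (1 - c t) + 2 * t * deriv c t) * hsB

theorem radialOp_truncAffine {s A B : ℝ} (hsB : s * B = 0) (T t : ℝ) :
    radialOp s (truncAffine A B T) t = T⁻¹ * (2 * (B + s * A) * deriv cutoff (T⁻¹ * t) +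
      (T⁻¹ * A + B * (T⁻¹ * t)) * deriv (deriv cutoff) (T⁻¹ * t)) := by
  have hcut : ContDiff ℝ 2 fun t => cutoff (T⁻¹ * t) :=
    contDiff_cutoff.comp (contDiff_const.mul contDiff_id)
  unfold truncAffine
  rw [radialOp_affine_mul_one_sub hsB hcut, deriv_deriv_cutoff_mul, deriv_cutoff_mul]
  ring

theorem radialOp_truncAffine_eq_zero {s A B T t : ℝ} (hsB : s * B = 0) (hT : 0 < T)
    (ht : t ∉ Icc T (2 * T)) : radialOp s (truncAffine A B T) t = 0 := by
  have hmem : T⁻¹ * t ∉ Icc 1 2 := by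
    rwa [inv_mul_eq_div, mem_Icc, le_div_iff₀ hT, div_le_iff₀ hT, one_mul]
  rw [radialOp_truncAffine hsB, deriv_cutoff_eq_zero hmem, deriv_deriv_cutoff_eq_zero hmem]
  ring

theorem hasCompactSupport_radialOp_truncAffine {s A B T : ℝ} (hsB : s * B = 0) (hT : 0 < T) :
    HasCompactSupport (radialOp s (truncAffine A B T)) :=
  HasCompactSupport.intro isCompact_Icc fun _ ht => radialOp_truncAffine_eq_zero hsB hT ht

theorem integral_radialOp {s c : ℝ} {y : ℝ → ℝ} (hy : ContDiff ℝ 2 y)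
    (hint : Integrable (radialOp s y))
    (hbot : Tendsto (fun t => deriv y t + 2 * s * y t) atBot (𝓝 c))
    (htop : Tendsto (fun t => deriv y t + 2 * s * y t) atTop (𝓝 0)) :
    ∫ t, radialOp s y t = c := by
  have hflux (t : ℝ) :
      HasDerivAt (fun t => -(deriv y t + 2 * s * y t)) (radialOp s y t) t :=
    ((hy.differentiable_deriv_two t).hasDerivAt.add
      ((hy.differentiable (by simp) t).hasDerivAt.const_mul (2 * s))).neg.congr_deriv
      (by rw [radialOp]; ring)
  rw [integral_of_hasDerivAt_of_tendsto hflux hint hbot.neg htop.neg]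
  ring

theorem integral_radialOp_truncAffine {s A B T : ℝ} (hsB : s * B = 0) (hT : 0 < T) :
    ∫ t, radialOp s (truncAffine A B T) t = B + 2 * s * A := by
  have hy : ContDiff ℝ 2 (truncAffine A B T) :=
    (contDiff_truncAffine A B T).of_le ENat.LEInfty.out
  refine integral_radialOp hy ((continuous_radialOp s hy).integrable_of_hasCompactSupport
    (hasCompactSupport_radialOp_truncAffine hsB hT)) ?_ ?_
  · refine tendsto_const_nhds.congr' ?_
    filter_upwards [eventually_lt_atBot T] with t ht
    have hnear : truncAffine A B T =ᶠ[𝓝 t] fun t => A + B * t :=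
      (eventually_lt_nhds ht).mono fun v hv => truncAffine_eq_affine A B hT hv.le
    rw [hnear.deriv_eq, hnear.eq_of_nhds, (hasDerivAt_affine A B t).deriv]
    linear_combination -2 * t * hsB
  · refine tendsto_const_nhds.congr' ?_
    filter_upwards [eventually_gt_atTop (2 * T)] with t ht
    have hnear : truncAffine A B T =ᶠ[𝓝 t] fun _ => 0 :=
      (eventually_gt_nhds ht).mono fun v hv => truncAffine_eq_zero A B hT hv
    rw [hnear.deriv_eq, hnear.eq_of_nhds, deriv_const]
    ring

theorem exists_integral_abs_radialOp_truncAffine_le {s A B : ℝ} (hsB : s * B = 0) :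
    ∃ D, ∀ T, 1 ≤ T → ∫ t, |radialOp s (truncAffine A B T) t| ≤ D := by
  set P : ℝ → ℝ := fun u => |2 * (B + s * A) * deriv cutoff u| +
    (|A| + |B * u|) * |deriv (deriv cutoff) u|
  have hP : Integrable P := by
    have hcut := (contDiff_deriv_cutoff (m := 0)).continuous
    have hcut' := continuous_deriv_deriv_cutoff
    refine Continuous.integrable_of_hasCompactSupport (by fun_prop)
      (HasCompactSupport.intro (isCompact_Icc (a := 1) (b := 2)) fun u hu => ?_)
    simp [P, deriv_cutoff_eq_zero hu, deriv_deriv_cutoff_eq_zero hu]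
  refine ⟨∫ u, P u, fun T hT => ?_⟩
  have hT0 : 0 < T := zero_lt_one.trans_le hT
  have hscaled : ∫ t, T⁻¹ * P (T⁻¹ * t) = ∫ u, P u := by
    rw [integral_const_mul, Measure.integral_comp_inv_mul_left, abs_of_pos hT0, smul_eq_mul,
      inv_mul_cancel_left₀ hT0.ne']
  rw [← hscaled]
  refine integral_mono_of_nonneg (.of_forall fun t => abs_nonneg _)
    ((hP.comp_mul_left' (inv_ne_zero hT0.ne')).const_mul _) (.of_forall fun t => ?_)
  have hA : |T⁻¹ * A| ≤ |A| := by
    rw [abs_mul, abs_of_pos (inv_pos.2 hT0)]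
    exact mul_le_of_le_one_left (abs_nonneg A) (inv_le_one_of_one_le₀ hT)
  simp only [radialOp_truncAffine hsB, abs_mul T⁻¹, abs_of_pos (inv_pos.2 hT0), P]
  gcongr
  refine (abs_add_le _ _).trans ?_
  gcongr
  rw [abs_mul _ (deriv (deriv cutoff) _)]
  gcongr
  exact (abs_add_le _ _).trans (by gcongr)

theorem abs_logProfile (n k : ℕ) (y : ℝ → ℝ) (x : Space n) :
    |logProfile n k y x| = logProfile n k (fun t => |y t|) x := by
  rw [logProfile, logProfile, abs_mul, abs_mul, abs_of_nonneg (sq_nonneg (x (Fin.last n))),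
    abs_of_nonneg (by positivity)]

theorem psiOneSqIntegral_nonneg (n : ℕ) : 0 ≤ psiOneSqIntegral n :=
  integral_nonneg fun _ => sq_nonneg _

theorem eventually_logProfile_radialOp_truncAffine_eq_zero {n : ℕ} {s A B : ℝ} (hsB : s * B = 0)
    {S : Set (Space n)} (hS : S ∈ 𝓝[halfSpace n] 0) (k : ℕ) :
    ∀ᶠ T in atTop, ∀ x ∈ halfSpace n, x ∉ S →
      logProfile n k (radialOp s (truncAffine A B T)) x = 0 := by
  obtain ⟨a, ha, haS⟩ := Metric.mem_nhdsWithin_iff.1 hS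
  filter_upwards [eventually_gt_atTop 0, eventually_gt_atTop (-Real.log a)] with T hT hTa x hx hxS
  have hax : a ≤ ‖x‖ := not_lt.1 fun hxa => hxS (haS ⟨by simpa using hxa, hx⟩)
  have hτ : -Real.log ‖x‖ ∉ Icc T (2 * T) := fun h => by
    linarith [h.1, Real.log_le_log ha hax]
  rw [logProfile, radialOp_truncAffine_eq_zero hsB hT hτ, mul_zero, mul_zero]

theorem tendsto_setIntegral_mul_logProfile_radialOp_truncAffine {n : ℕ} {s A B z : ℝ}
    (hsB : s * B = 0) {ζ : Space n → ℝ} (hζ : MemLp ζ ⊤ (volume.restrict (halfSpace n)))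
    (hz : Tendsto ζ (𝓝[halfSpace n] 0) (𝓝 z)) :
    Tendsto (fun T => ∫ x in halfSpace n,
        ζ x * logProfile n (n + 3) (radialOp s (truncAffine A B T)) x) atTop
      (𝓝 (z * (psiOneSqIntegral n * (B + 2 * s * A)))) := by
  obtain ⟨D, hD⟩ := exists_integral_abs_radialOp_truncAffine_le (A := A) hsB
  refine tendsto_integral_mul_of_concentrating (D := psiOneSqIntegral n * D) hζ hz ?_ ?_ ?_
    fun S hS => ?_
  · filter_upwards [eventually_gt_atTop 0] with T hT
    exact integrableOn_logProfile
      (continuous_radialOp s ((contDiff_truncAffine A B T).of_le ENat.LEInfty.out))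
      (hasCompactSupport_radialOp_truncAffine hsB hT)
  · filter_upwards [eventually_ge_atTop 1] with T hT
    simp only [abs_logProfile, setIntegral_logProfile]
    exact mul_le_mul_of_nonneg_left (hD T hT) (psiOneSqIntegral_nonneg n)
  · filter_upwards [eventually_gt_atTop 0] with T hT
    rw [setIntegral_logProfile, integral_radialOp_truncAffine hsB hT]
  · filter_upwards [eventually_logProfile_radialOp_truncAffine_eq_zero hsB hS (n + 3)] with T hT
    exact ae_restrict_of_forall_mem (isOpen_halfSpace n).measurableSet hT

theorem tendsto_integral_mul_logProfile_truncAffine {n k : ℕ} {ν : Measure (Space n)} {A B : ℝ}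
    {g : Space n → ℝ} (hgm : AEStronglyMeasurable g ν)
    (hg : Integrable (fun x => g x * logProfile n k (fun t => A + B * t) x) ν) :
    Tendsto (fun T => ∫ x, g x * logProfile n k (truncAffine A B T) x ∂ν) atTop
      (𝓝 (∫ x, g x * logProfile n k (fun t => A + B * t) x ∂ν)) := by
  refine tendsto_integral_filter_of_dominated_convergence _
    (.of_forall fun T => hgm.mul (measurable_logProfile n k
      (contDiff_truncAffine A B T).continuous.measurable).aestronglyMeasurable)
    (.of_forall fun T => .of_forall fun x => ?_) hg.norm (.of_forall fun x => ?_)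
  · rw [norm_mul, norm_mul, Real.norm_eq_abs (logProfile ..), Real.norm_eq_abs (logProfile ..),
      abs_logProfile, abs_logProfile, logProfile, logProfile]
    gcongr _ * (_ * (_ * ?_))
    exact abs_truncAffine_le A B T _
  · refine tendsto_const_nhds.congr' ?_
    filter_upwards [eventually_gt_atTop 0, eventually_ge_atTop (-Real.log ‖x‖)] with T hT hxT
    rw [logProfile, logProfile, truncAffine_eq_affine A B hT hxT]

theorem IsDualOf.setIntegral_mul_logProfile_affine {n : ℕ} {μ A B R z : ℝ} {ζ g : Space n → ℝ}
    (hsB : √(μ - muOne n) * B = 0) (hg : IsDualOf n μ ζ g)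
    (hζ : MemLp ζ ⊤ (volume.restrict (halfSpace n)))
    (hR : ∀ᵐ x ∂volume.restrict (halfSpace n), R < ‖x‖ → ζ x = 0)
    (hz : Tendsto ζ (𝓝[halfSpace n] 0) (𝓝 z))
    (hρg : MemLp (fun x => rho n x * g x) ⊤ (volume.restrict (halfSpace n)))
    (hint : IntegrableOn (fun x => g x * logProfile n (n + 1) (fun t => A + B * t) x)
      (halfSpace n)) :
    ∫ x in halfSpace n, g x * logProfile n (n + 1) (fun t => A + B * t) x =
      psiOneSqIntegral n * (B + 2 * √(μ - muOne n) * A) * z := by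
  have htrunc : ∀ᶠ T in atTop,
      ∫ x in halfSpace n, ζ x *
        logProfile n (n + 3) (radialOp √(μ - muOne n) (truncAffine A B T)) x =
      ∫ x in halfSpace n, g x * logProfile n (n + 1) (truncAffine A B T) x := by
    filter_upwards [eventually_gt_atTop 0] with T hT
    exact (hg.setIntegral_mul_logProfile_of_eq_zero hζ hρg hR (contDiff_truncAffine A B T)
      fun t ht => truncAffine_eq_zero A B hT ht).symm
  have hmass := tendsto_setIntegral_mul_logProfile_radialOp_truncAffine (A := A) hsB hζ hz
  rw [tendsto_nhds_unique (tendsto_integral_mul_logProfile_truncAffine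
    hg.1.aestronglyMeasurable hint) (hmass.congr' htrunc), mul_comm]

theorem rpow_mul_rpow_eq_sq_mul_inv_pow {n : ℕ} {r a b : ℝ} (hr : 0 < r) (hab : a + b = 1 - n) :
    r ^ a * r ^ b = r ^ 2 * (r ^ (n + 1))⁻¹ := by
  rw [← Real.rpow_add hr, hab, ← div_eq_mul_inv, ← Real.rpow_natCast, ← Real.rpow_natCast,
    ← Real.rpow_sub hr]
  congr 1
  push_cast
  ring

theorem phiFun_mul_gammaFun_of_eq {n : ℕ} {μ : ℝ} (hμ : μ = muOne n) {x : Space n}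
    (hx : x ∈ halfSpace n) :
    phiFun n μ x * gammaFun n μ x = logProfile n (n + 1) (fun t => 0 + 1 * t) x := by
  have hr := norm_pos_of_mem_halfSpace hx
  have hpow := rpow_mul_rpow_eq_sq_mul_inv_pow (n := n) hr
    (a := -(((n : ℝ) + 1) - 2) / 2) (b := alphaPlus n μ)
    (by rw [alphaPlus, hμ, sub_self, Real.sqrt_zero]; ring)
  calc phiFun n μ x * gammaFun n μ x
      = (‖x‖ ^ (-(((n : ℝ) + 1) - 2) / 2) * ‖x‖ ^ alphaPlus n μ) * -Real.log ‖x‖ *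
        (x (Fin.last n) / ‖x‖) ^ 2 := by
        rw [phiFun, if_pos hμ, gammaFun, psiOne, Real.log_inv]
        ring
    _ = logProfile n (n + 1) (fun t => 0 + 1 * t) x := by
        rw [hpow, logProfile]
        field_simp
        ring

theorem phiFun_mul_gammaFun_of_ne {n : ℕ} {μ : ℝ} (hμ : μ ≠ muOne n) {x : Space n}
    (hx : x ∈ halfSpace n) :
    phiFun n μ x * gammaFun n μ x = logProfile n (n + 1) (fun t => 1 + 0 * t) x := by
  have hr := norm_pos_of_mem_halfSpace hx
  have hpow := rpow_mul_rpow_eq_sq_mul_inv_pow (n := n) hr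
    (a := alphaMinus n μ) (b := alphaPlus n μ) (by rw [alphaMinus, alphaPlus]; ring)
  calc phiFun n μ x * gammaFun n μ x
      = (‖x‖ ^ alphaMinus n μ * ‖x‖ ^ alphaPlus n μ) * (x (Fin.last n) / ‖x‖) ^ 2 := by
        rw [phiFun, if_neg hμ, gammaFun, psiOne]
        ring
    _ = logProfile n (n + 1) (fun t => 1 + 0 * t) x := by
        rw [hpow, logProfile]
        field_simp
        ring

theorem exists_phiFun_mul_gammaFun_eq_logProfile (n : ℕ) (μ : ℝ) : ∃ A B : ℝ,
    √(μ - muOne n) * B = 0 ∧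
    psiOneSqIntegral n * (B + 2 * √(μ - muOne n) * A) = cConst n μ ∧
    ∀ x ∈ halfSpace n,
      phiFun n μ x * gammaFun n μ x = logProfile n (n + 1) (fun t => A + B * t) x := by
  by_cases hμ : μ = muOne n
  · exact ⟨0, 1, by simp [hμ], by simp [hμ, cConst], fun _ => phiFun_mul_gammaFun_of_eq hμ⟩
  · exact ⟨1, 0, by simp, by simp [hμ, cConst, mul_comm], fun _ => phiFun_mul_gammaFun_of_ne hμ⟩

theorem integrableOn_ball_inv_norm_pow_mul_affine (n : ℕ) (A B R : ℝ) :
    IntegrableOn (fun x : Space n => (‖x‖ ^ n)⁻¹ * (A + B * -Real.log ‖x‖))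
      (Metric.ball 0 R) := by
  rw [integrableOn_fun_norm_addHaar volume (E := Space n)
    (f := fun r => (r ^ n)⁻¹ * (A + B * -Real.log r))]
  have hlog : IntegrableOn Real.log (Ioo 0 R) :=
    intervalIntegral.intervalIntegrable_log'.1.mono_set Ioo_subset_Ioc_self
  have haffine : IntegrableOn (fun r => A + B * -Real.log r) (Ioo 0 R) :=
    (integrableOn_const (by simp)).add (hlog.neg.const_mul B)
  refine haffine.congr_fun (fun r hr => ?_) measurableSet_Ioo
  simp only [finrank_euclideanSpace_fin, Nat.add_sub_cancel, smul_eq_mul]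
  rw [mul_inv_cancel_left₀ (pow_ne_zero n hr.1.ne')]

theorem integrable_withDensity_ofReal_iff {α : Type*} [MeasurableSpace α] {ν : Measure α}
    {w f : α → ℝ} (hw : Measurable w) (hw_nonneg : 0 ≤ᵐ[ν] w) :
    Integrable f (ν.withDensity fun x => ENNReal.ofReal (w x)) ↔
      Integrable (fun x => w x * f x) ν := by
  rw [integrable_withDensity_iff_integrable_smul' hw.ennreal_ofReal
    (.of_forall fun _ => ENNReal.ofReal_lt_top)]
  refine integrable_congr ?_
  filter_upwards [hw_nonneg] with x hx
  rw [ENNReal.toReal_ofReal hx, smul_eq_mul]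

theorem integral_withDensity_ofReal {α : Type*} [MeasurableSpace α] {ν : Measure α}
    {w : α → ℝ} (hw : Measurable w) (hw_nonneg : 0 ≤ᵐ[ν] w) (f : α → ℝ) :
    ∫ x, f x ∂ν.withDensity (fun x => ENNReal.ofReal (w x)) = ∫ x, w x * f x ∂ν := by
  rw [integral_withDensity_eq_integral_toReal_smul hw.ennreal_ofReal
    (.of_forall fun _ => ENNReal.ofReal_lt_top)]
  refine integral_congr_ae ?_
  filter_upwards [hw_nonneg] with x hx
  rw [ENNReal.toReal_ofReal hx, smul_eq_mul]

theorem measurable_gammaFun (n : ℕ) (μ : ℝ) : Measurable (gammaFun n μ) := by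
  have := measurable_lastCoord n
  unfold gammaFun psiOne
  fun_prop

theorem gammaFun_nonneg_ae (n : ℕ) (μ : ℝ) : 0 ≤ᵐ[volume.restrict (halfSpace n)] gammaFun n μ :=
  ae_restrict_of_forall_mem (isOpen_halfSpace n).measurableSet fun _ hx => (gammaFun_pos μ hx).le

theorem inv_rho_nonneg_ae (n : ℕ) :
    0 ≤ᵐ[volume.restrict (halfSpace n)] fun x => (rho n x)⁻¹ :=
  ae_restrict_of_forall_mem (isOpen_halfSpace n).measurableSet fun _ hx => inv_nonneg.2 hx.le

theorem locallyIntegrable_phiFun (n : ℕ) (μ : ℝ) :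
    LocallyIntegrable (phiFun n μ) (rhoInvGammaMeasure n μ) := by
  obtain ⟨A, B, -, -, hφ⟩ := exists_phiFun_mul_gammaFun_eq_logProfile n μ
  intro x₀
  refine ⟨Metric.ball 0 (‖x₀‖ + 1), Metric.isOpen_ball.mem_nhds (by simp), ?_⟩
  have hball : Integrable (fun x : Space n => (‖x‖ ^ n)⁻¹ * (A + B * -Real.log ‖x‖))
      ((volume.restrict (halfSpace n)).restrict (Metric.ball 0 (‖x₀‖ + 1))) :=
    (integrableOn_ball_inv_norm_pow_mul_affine n A B _).mono_measure Measure.restrict_le_self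
  rw [IntegrableOn, rhoInvGammaMeasure, gammaMeasure, restrict_withDensity measurableSet_ball,
    restrict_withDensity measurableSet_ball,
    integrable_withDensity_ofReal_iff (w := fun x => (rho n x)⁻¹) (measurable_lastCoord n).inv
      ((withDensity_absolutelyContinuous _ _).ae_le (ae_restrict_of_ae (inv_rho_nonneg_ae n))),
    integrable_withDensity_ofReal_iff (measurable_gammaFun n μ)
      (ae_restrict_of_ae (gammaFun_nonneg_ae n μ))]
  refine (integrable_lastCoord_mul_inv_norm_pow_mul (y := fun t => A + B * t) (by fun_prop)
    hball).congr (ae_restrict_of_ae ?_)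
  filter_upwards [ae_restrict_mem (isOpen_halfSpace n).measurableSet] with x hx
  have hz : x (Fin.last n) ≠ 0 := ne_of_gt hx
  calc x (Fin.last n) * ((‖x‖ ^ (n + 1))⁻¹ * (A + B * -Real.log ‖x‖))
      = (x (Fin.last n))⁻¹ * (phiFun n μ x * gammaFun n μ x) := by
        rw [hφ x hx, logProfile]
        field_simp
    _ = gammaFun n μ x * ((rho n x)⁻¹ * phiFun n μ x) := by rw [rho]; ring

theorem IsDualOf.integrableOn_mul_logProfile_affine {n : ℕ} {μ R : ℝ} {ζ g : Space n → ℝ}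
    (hg : IsDualOf n μ ζ g)
    (hR : ∀ᵐ x ∂volume.restrict (halfSpace n), R < ‖x‖ → ζ x = 0)
    (hρg : MemLp (fun x => rho n x * g x) ⊤ (volume.restrict (halfSpace n))) (A B : ℝ) :
    IntegrableOn (fun x => g x * logProfile n (n + 1) (fun t => A + B * t) x) (halfSpace n) := by
  have hball : IntegrableOn (fun x => g x * logProfile n (n + 1) (fun t => A + B * t) x)
      (Metric.ball 0 (R + 1)) (volume.restrict (halfSpace n)) :=
    integrable_mul_logProfile (hρg.restrict _) (by fun_prop)
      ((integrableOn_ball_inv_norm_pow_mul_affine n A B _).mono_measure Measure.restrict_le_self)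
  refine hball.integrable_of_ae_notMem_eq_zero ?_
  filter_upwards [hg.ae_eq_zero_of_isOpen (isOpen_lt continuous_const continuous_norm) hR]
    with x hx hxR
  have hnorm : R + 1 ≤ ‖x‖ := by simpa using hxR
  rw [hx (show R < ‖x‖ by linarith), zero_mul]

theorem proposition2p1_general {n : ℕ} {μ : ℝ} (_ : muOne n ≤ μ) :
    LocallyIntegrable (phiFun n μ) (rhoInvGammaMeasure n μ) ∧
    ∀ (ζ g : Space n → ℝ) (R z : ℝ), MemLp ζ ⊤ (volume.restrict (halfSpace n)) →
      (∀ᵐ x ∂volume.restrict (halfSpace n), R < ‖x‖ → ζ x = 0) →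
      Tendsto ζ (𝓝[halfSpace n] 0) (𝓝 z) → IsDualOf n μ ζ g →
      MemLp (fun x => rho n x * g x) ⊤ (volume.restrict (halfSpace n)) →
      Integrable (fun x => phiFun n μ x * g x) (gammaMeasure n μ) ∧
      ∫ x, phiFun n μ x * g x ∂(gammaMeasure n μ) = cConst n μ * z := by
  obtain ⟨A, B, hsB, hc, hφ⟩ := exists_phiFun_mul_gammaFun_eq_logProfile n μ
  refine ⟨locallyIntegrable_phiFun n μ, fun ζ g R z hζ hR hz hg hρg => ?_⟩
  have hint := hg.integrableOn_mul_logProfile_affine hR hρg A B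
  have hdensity : EqOn (fun x => g x * logProfile n (n + 1) (fun t => A + B * t) x)
      (fun x => gammaFun n μ x * (phiFun n μ x * g x)) (halfSpace n) := fun x hx => by
    simp only [← hφ x hx]
    ring
  have hH := (isOpen_halfSpace n).measurableSet
  have hγ := measurable_gammaFun n μ
  constructor
  · rw [gammaMeasure, integrable_withDensity_ofReal_iff hγ (gammaFun_nonneg_ae n μ)]
    exact hint.congr_fun hdensity hH
  · rw [gammaMeasure, integral_withDensity_ofReal hγ (gammaFun_nonneg_ae n μ),
      ← setIntegral_congr_fun hH hdensity,
      hg.setIntegral_mul_logProfile_affine hsB hζ hR hz hρg hint, hc]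

section TestSpace

variable {n : ℕ} {μ : ℝ} {ζ : Space n → ℝ}

theorem exists_forall_norm_gt_eq_zero_of_mem_testSpace (hζ : ζ ∈ testSpace n μ) :
    ∃ R, ∀ x ∈ halfSpace n, R < ‖x‖ → ζ x = 0 := by
  obtain ⟨-, ⟨K, hK, hζK⟩, -⟩ := hζ
  obtain ⟨R, hR⟩ := hK.isBounded.exists_norm_le
  exact ⟨R, fun x hx hxR => hζK x ⟨subset_closure hx, fun hxK => (hR x hxK).not_gt hxR⟩⟩

theorem memLp_top_of_mem_testSpace (hζ : ζ ∈ testSpace n μ) :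
    MemLp ζ ⊤ (volume.restrict (halfSpace n)) := by
  have hH := (isOpen_halfSpace n).measurableSet
  obtain ⟨hcont, ⟨K, hK, hζK⟩, -⟩ := hζ
  obtain ⟨C, hC⟩ := (hK.inter_right isClosed_closure).exists_bound_of_continuousOn
    (hcont.mono inter_subset_right)
  refine memLp_top_of_bound ((hcont.mono subset_closure).aestronglyMeasurable hH) (max C 0)
    (ae_restrict_of_forall_mem hH fun x hx => ?_)
  by_cases hxK : x ∈ K
  · exact (hC x ⟨hxK, subset_closure hx⟩).trans (le_max_left _ _)
  · simp [hζK x ⟨subset_closure hx, hxK⟩]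

theorem zero_mem_closure_halfSpace (n : ℕ) : (0 : Space n) ∈ closure (halfSpace n) := by
  have hray : Continuous fun t : ℝ => t • (EuclideanSpace.single (Fin.last n) 1 : Space n) := by
    fun_prop
  have hlim := (hray.tendsto 0).mono_left (nhdsWithin_le_nhds (s := Ioi 0))
  rw [zero_smul] at hlim
  refine mem_closure_of_tendsto hlim ?_
  filter_upwards [self_mem_nhdsWithin] with t ht
  simpa [halfSpace] using ht

theorem tendsto_nhdsWithin_zero_of_mem_testSpace (hζ : ζ ∈ testSpace n μ) :
    Tendsto ζ (𝓝[halfSpace n] 0) (𝓝 (ζ 0)) :=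
  (hζ.1 0 (zero_mem_closure_halfSpace n)).mono_left (nhdsWithin_mono 0 subset_closure)

theorem IsDualOf.memLp_rho_mul {g : Space n → ℝ} (hg : IsDualOf n μ ζ g)
    (hζ : ζ ∈ testSpace n μ) :
    MemLp (fun x => rho n x * g x) ⊤ (volume.restrict (halfSpace n)) := by
  obtain ⟨-, -, g', hg', hρg'⟩ := hζ
  refine hρg'.ae_eq ?_
  filter_upwards [hg'.ae_eq hg] with x hx
  rw [hx]

end TestSpace

end

theorem proposition2p1 (n : ℕ) (hn : 1 ≤ n) (μ : ℝ) (hμ : muOne n ≤ μ) :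
    LocallyIntegrableOn (phiFun n μ) (closure (halfSpace n)) (rhoInvGammaMeasure n μ) ∧
    ∀ ζ ∈ testSpace n μ, ∀ g : Space n → ℝ, IsDualOf n μ ζ g →
      Integrable (fun x => phiFun n μ x * g x) (gammaMeasure n μ) ∧
      ∫ x, phiFun n μ x * g x ∂(gammaMeasure n μ) = cConst n μ * ζ 0 := by
  obtain ⟨hφ, hrep⟩ := proposition2p1_general hμ
  refine ⟨hφ.locallyIntegrableOn _, fun ζ hζ g hg => ?_⟩
  obtain ⟨R, hR⟩ := exists_forall_norm_gt_eq_zero_of_mem_testSpace hζ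
  exact hrep ζ g R (ζ 0) (memLp_top_of_mem_testSpace hζ)
    (ae_restrict_of_forall_mem (isOpen_halfSpace n).measurableSet hR)
    (tendsto_nhdsWithin_zero_of_mem_testSpace hζ) hg (hg.memLp_rho_mul hζ)
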